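/- **Theorem 1.10.** Let $k$ be a field of characteristic zero. A *Poisson algebra* is a commutative $k$-algebra $A$ with a $k$-bilinear Lie bracket $\{-,-\}$ that is a derivation in each variable. A *Poisson ideal* is an ideal $I$ with $\{A,I\}\subseteq I$; a *Poisson prime* is a prime ideal that is a Poisson ideal; the set $\operatorname{P.spec}A$ of Poisson primes carries the topology induced by the Zariski topology of $\operatorname{spec}A$. Let $A$ be a Poisson algebra, not necessarily a polynomial ring, on which a torus $H=(k^\times)^r$ ($r\ge 0$) acts by $k$-algebra automorphisms preserving the bracket. Assume that the action is *rational*, i.e. $A$ is generated as a $k$-algebra by $H$-eigenvectors whose eigenvalues are characters of the form $h\mapsto h^m:=h_1^{m_1}\cdots h_r^{m_r}$ with $m\in\mathbb Z^r$; then $A=\bigoplus_{m\in\mathbb Z^r}A_m$ with $A_m=\{a\in A\mid h.a=h^m a \text{ for all } h\in H\}$. The Lie algebra $\mathfrak h=\operatorname{Lie}H=k^r$ acts on $A$ by the differential of this action, i.e. linearly with $\eta.a=(\eta_1m_1+\cdots+\eta_rm_r)\,a$ for $\eta\in\mathfrak h$ and $a\in A_m$. Assume that $A$ is generated as a $k$-algebra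 by $H$-eigenvectors $x_1,\dots,x_n$ ($n\ge 0$), and that there exist $\eta_1,\dots,\eta_n\in\mathfrak h$ such that 1. $\{x_i,x_j\}-(\eta_i.x_j)x_i\in k\langle x_1,\dots,x_{i-1}\rangle$ for all $i>j$, where $k\langle x_1,\dots,x_{i-1}\rangle$ is the $k$-subalgebra of $A$ generated by $x_1,\dots,x_{i-1}$; 2. for all $i$, the $\eta_i$-eigenvalue of $x_i$ is nonzero. Then $A$ has at most $2^n$ $H$-stable Poisson primes, and $A$ satisfies the *Poisson Dixmier–Moeglin equivalence*, i.e. the following three sets coincide: * the set of Poisson primitive ideals of $A$, that is, of the ideals of the form: the largest Poisson ideal contained in $M$, for $M$ a maximal ideal of $A$; * the set of locally closed points of $\operatorname{P.spec}A$; * the set of Poisson rational ideals, that is, of the Poisson primes $P$ such that the field $\{z\in\operatorname{Fract}(A/P)\mid \{z,-\}=0\}$ is algebraic over $k$, for the unique extension to $\operatorname{Fract}(A/P)$ of the bracket induced on $A/P$. -/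

import Mathlib

/-!
Poisson algebras, Poisson primes, the Poisson Dixmier-Moeglin equivalence, rational torus actions
and the differential of a rational torus action.
-/

/-- A Poisson algebra over `k`: a commutative `k`-algebra with a `k`-bilinear Lie bracket which is
a derivation in the second variable (hence, by antisymmetry, in each variable). -/
class PoissonAlgebra (k A : Type*) [CommRing k] [CommRing A] [Algebra k A] where
  bracket : A →ₗ[k] A →ₗ[k] A
  bracket_self : ∀ a, bracket a a = 0
  jacobi : ∀ a b c,
    bracket a (bracket b c) + bracket b (bracket c a) + bracket c (bracket a b) = 0
  leibniz : ∀ a b c, bracket a (b * c) = bracket a b * c + b * bracket a c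

namespace PoissonAlgebra

section Basic

variable (k : Type*) {A : Type*} [CommRing k] [CommRing A] [Algebra k A] [PoissonAlgebra k A]

/-- The Poisson bracket `{a, b}`. -/
def pb (a b : A) : A := bracket (k := k) a b

theorem pb_self (a : A) : pb k a a = 0 := bracket_self a

theorem pb_skew (a b : A) : pb k a b = - pb k b a := by
  have h := pb_self k (a + b)
  simp only [pb, map_add, LinearMap.add_apply, bracket_self, zero_add, add_zero] at h ⊢
  exact eq_neg_of_add_eq_zero_right h

theorem pb_mul_right (a b c : A) : pb k a (b * c) = pb k a b * c + b * pb k a c :=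
  leibniz a b c

theorem pb_mul_left (a b c : A) : pb k (a * b) c = pb k a c * b + a * pb k b c := by
  rw [pb_skew, pb_mul_right, pb_skew k c a, pb_skew k c b]; ring

theorem pb_jacobi (a b c : A) :
    pb k a (pb k b c) + pb k b (pb k c a) + pb k c (pb k a b) = 0 := jacobi a b c

theorem pb_add_left (a b c : A) : pb k (a + b) c = pb k a c + pb k b c := by simp [pb]
theorem pb_add_right (a b c : A) : pb k a (b + c) = pb k a b + pb k a c := by simp [pb]
theorem pb_smul_left (r : k) (a b : A) : pb k (r • a) b = r • pb k a b := by simp [pb]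
theorem pb_smul_right (r : k) (a b : A) : pb k a (r • b) = r • pb k a b := by simp [pb]
theorem pb_sub_right (a b c : A) : pb k a (b - c) = pb k a b - pb k a c := by simp [pb]
theorem pb_sub_left (a b c : A) : pb k (a - b) c = pb k a c - pb k b c := by simp [pb]

theorem pb_algebraMap_right (a : A) (r : k) : pb k a (algebraMap k A r) = 0 := by
  have h := pb_mul_right k a 1 1
  simp only [mul_one, one_mul, left_eq_add] at h
  rw [Algebra.algebraMap_eq_smul_one, pb_smul_right, h, smul_zero]

/-- The Hamiltonian derivation `{a, -}`. -/
def ham (a : A) : Derivation k A A :=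
  Derivation.mk' (bracket (k := k) a) fun b c => by
    rw [leibniz]; simp only [smul_eq_mul]; ring

theorem ham_apply (a b : A) : ham k a b = pb k a b := rfl

/-- The Poisson center `{z | {z, -} = 0}`. -/
def center (k A : Type*) [CommRing k] [CommRing A] [Algebra k A] [PoissonAlgebra k A] :
    Subalgebra k A where
  carrier := {z | ∀ a : A, pb k z a = 0}
  mul_mem' := fun {x y} hx hy a => by rw [pb_mul_left, hx a, hy a]; ring
  add_mem' := fun {x y} hx hy a => by rw [pb_add_left, hx a, hy a, add_zero]
  algebraMap_mem' := fun r a => by rw [pb_skew, pb_algebraMap_right, neg_zero]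

/-- A Poisson ideal: an ideal `I` with `{A, I} ⊆ I`. -/
def IsPoissonIdeal (I : Ideal A) : Prop := ∀ a : A, ∀ b ∈ I, pb k a b ∈ I

/-- A Poisson prime ideal: a prime ideal which is also a Poisson ideal. -/
def IsPoissonPrime (P : Ideal A) : Prop := P.IsPrime ∧ IsPoissonIdeal k P

/-- The Poisson prime spectrum, with the topology induced from the Zariski topology
(the subtype topology). -/
abbrev PSpec (k A : Type*) [CommRing k] [CommRing A] [Algebra k A] [PoissonAlgebra k A] : Type _ :=
  {P : PrimeSpectrum A // IsPoissonIdeal k P.asIdeal}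

/-- The Poisson core of an ideal `J`: the largest Poisson ideal contained in `J`. -/
def core (J : Ideal A) : Ideal A := sSup {I | IsPoissonIdeal k I ∧ I ≤ J}

theorem isGreatest_core (J : Ideal A) :
    IsGreatest {I : Ideal A | IsPoissonIdeal k I ∧ I ≤ J} (core k J) := by
  refine ⟨⟨fun a b hb => ?_, sSup_le fun I hI => hI.2⟩, fun I hI => le_sSup hI⟩
  unfold core at hb ⊢
  rw [sSup_eq_iSup'] at hb ⊢
  refine Submodule.iSup_induction _ (motive := fun b => pb k a b ∈ _) hb ?_ ?_ ?_
  · intro I x hx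
    exact Submodule.mem_iSup_of_mem I (I.2.1 a x hx)
  · simp [pb]
  · intro x y hx hy
    rw [pb_add_right]; exact add_mem hx hy

/-- A Poisson primitive ideal: the Poisson core of a maximal ideal. -/
def IsPoissonPrimitive (P : Ideal A) : Prop := ∃ M : Ideal A, M.IsMaximal ∧ P = core k M

end Basic

section Quotient

theorem smul_mk {k A : Type*} [CommRing k] [CommRing A] [Algebra k A]
    (I : Ideal A) (r : k) (a : A) :
    r • Ideal.Quotient.mk I a = Ideal.Quotient.mk I (r • a) := rfl

variable {k A : Type*} [CommRing k] [CommRing A] [Algebra k A] [PoissonAlgebra k A]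

theorem IsPoissonIdeal.pb_sub_mem {I : Ideal A} (hI : IsPoissonIdeal k I) {a a' b b' : A}
    (ha : a - a' ∈ I) (hb : b - b' ∈ I) : pb k a b - pb k a' b' ∈ I := by
  have h1 : pb k a (b - b') ∈ I := hI a _ hb
  have h2 : pb k b' (a - a') ∈ I := hI b' _ ha
  rw [pb_skew, pb_sub_left] at h2
  rw [pb_sub_right] at h1
  have := add_mem h1 (neg_mem h2)
  convert this using 1
  ring

/-- The bracket of two classes modulo a Poisson ideal. -/
def quotientPb {I : Ideal A} (hI : IsPoissonIdeal k I) (x y : A ⧸ I) : A ⧸ I :=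
  Quotient.map₂ (pb k) (fun a a' ha b b' hb => by
    have ha' := (Submodule.quotientRel_def I).1 ha
    have hb' := (Submodule.quotientRel_def I).1 hb
    exact (Submodule.quotientRel_def I).2 (hI.pb_sub_mem ha' hb')) x y

theorem quotientPb_mk {I : Ideal A} (hI : IsPoissonIdeal k I) (a b : A) :
    quotientPb hI (Ideal.Quotient.mk I a) (Ideal.Quotient.mk I b) =
      Ideal.Quotient.mk I (pb k a b) := rfl

/-- The induced Poisson bracket on the quotient by a Poisson ideal, `{ā, b̄} = class of {a, b}`. -/
@[reducible] def quotient {I : Ideal A} (hI : IsPoissonIdeal k I) : PoissonAlgebra k (A ⧸ I) where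
  bracket := LinearMap.mk₂ k (quotientPb hI)
    (fun x y z => by
      obtain ⟨a, rfl⟩ := Ideal.Quotient.mk_surjective x
      obtain ⟨b, rfl⟩ := Ideal.Quotient.mk_surjective y
      obtain ⟨c, rfl⟩ := Ideal.Quotient.mk_surjective z
      simp only [quotientPb_mk, ← map_add, pb_add_left])
    (fun r x y => by
      obtain ⟨a, rfl⟩ := Ideal.Quotient.mk_surjective x
      obtain ⟨b, rfl⟩ := Ideal.Quotient.mk_surjective y
      simp only [quotientPb_mk, smul_mk, pb_smul_left])
    (fun x y z => by
      obtain ⟨a, rfl⟩ := Ideal.Quotient.mk_surjective x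
      obtain ⟨b, rfl⟩ := Ideal.Quotient.mk_surjective y
      obtain ⟨c, rfl⟩ := Ideal.Quotient.mk_surjective z
      simp only [quotientPb_mk, ← map_add, pb_add_right])
    (fun r x y => by
      obtain ⟨a, rfl⟩ := Ideal.Quotient.mk_surjective x
      obtain ⟨b, rfl⟩ := Ideal.Quotient.mk_surjective y
      simp only [quotientPb_mk, smul_mk, pb_smul_right])
  bracket_self := fun x => by
    obtain ⟨a, rfl⟩ := Ideal.Quotient.mk_surjective x
    simp only [LinearMap.mk₂_apply, quotientPb_mk, pb_self, map_zero]
  jacobi := fun x y z => by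
    obtain ⟨a, rfl⟩ := Ideal.Quotient.mk_surjective x
    obtain ⟨b, rfl⟩ := Ideal.Quotient.mk_surjective y
    obtain ⟨c, rfl⟩ := Ideal.Quotient.mk_surjective z
    simp only [LinearMap.mk₂_apply, quotientPb_mk, ← map_add, pb_jacobi, map_zero]
  leibniz := fun x y z => by
    obtain ⟨a, rfl⟩ := Ideal.Quotient.mk_surjective x
    obtain ⟨b, rfl⟩ := Ideal.Quotient.mk_surjective y
    obtain ⟨c, rfl⟩ := Ideal.Quotient.mk_surjective z
    simp only [LinearMap.mk₂_apply, quotientPb_mk, ← map_add, ← map_mul, pb_mul_right]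

theorem quotient_pb_mk {I : Ideal A} (hI : IsPoissonIdeal k I) (a b : A) :
    letI := quotient hI
    pb k (Ideal.Quotient.mk I a) (Ideal.Quotient.mk I b) = Ideal.Quotient.mk I (pb k a b) := rfl

end Quotient

section Fraction

variable {k R : Type*} [Field k] [CommRing R] [IsDomain R] [Algebra k R]

section Lift

variable {M : Type*} [AddCommGroup M] [Module k M] [Module R M] [Module (FractionRing R) M]
  [IsScalarTower k R M] [IsScalarTower R (FractionRing R) M] [IsScalarTower k (FractionRing R) M]

/-- Two derivations of a quotient field which agree on the domain are equal. -/
theorem fraction_derivation_ext {D E : Derivation k (FractionRing R) M}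
    (h : ∀ a : R, D (algebraMap R (FractionRing R) a) = E (algebraMap R (FractionRing R) a)) :
    D = E := by
  ext z
  obtain ⟨a, s, hs, rfl⟩ := IsFractionRing.div_surjective (A := R) z
  have hs0 : algebraMap R (FractionRing R) s ≠ 0 :=
    IsFractionRing.to_map_ne_zero_of_mem_nonZeroDivisors hs
  have key : ∀ F : Derivation k (FractionRing R) M,
      algebraMap R (FractionRing R) s •
        F (algebraMap R (FractionRing R) a / algebraMap R (FractionRing R) s) =
      F (algebraMap R (FractionRing R) a) -
        (algebraMap R (FractionRing R) a / algebraMap R (FractionRing R) s) •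
          F (algebraMap R (FractionRing R) s) := by
    intro F
    have h1 := F.leibniz (algebraMap R (FractionRing R) s)
      (algebraMap R (FractionRing R) a / algebraMap R (FractionRing R) s)
    rw [mul_div_cancel₀ _ hs0] at h1
    rw [h1]; abel
  have h2 : algebraMap R (FractionRing R) s •
        D (algebraMap R (FractionRing R) a / algebraMap R (FractionRing R) s) =
      algebraMap R (FractionRing R) s •
        E (algebraMap R (FractionRing R) a / algebraMap R (FractionRing R) s) := by
    rw [key, key, h, h]
  exact smul_right_injective M hs0 h2

/-- The unique extension of a derivation of a domain, with values in a vector space over the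
quotient field, to the quotient field. -/
noncomputable def liftDerivation (D : Derivation k R M) : Derivation k (FractionRing R) M :=
  haveI : Algebra.FormallyEtale R (FractionRing R) :=
    Algebra.FormallyEtale.of_isLocalization (nonZeroDivisors R)
  ((KaehlerDifferential.isBaseChange_of_formallyEtale k R (FractionRing R)).lift
    D.liftKaehlerDifferential).compDer (KaehlerDifferential.D k (FractionRing R))

theorem liftDerivation_algebraMap (D : Derivation k R M) (a : R) :
    liftDerivation D (algebraMap R (FractionRing R) a) = D a := by
  have : Algebra.FormallyEtale R (FractionRing R) :=
    Algebra.FormallyEtale.of_isLocalization (nonZeroDivisors R)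
  have h := (KaehlerDifferential.isBaseChange_of_formallyEtale k R (FractionRing R)).lift_eq
    D.liftKaehlerDifferential (KaehlerDifferential.D k R a)
  rw [KaehlerDifferential.map_D, Derivation.liftKaehlerDifferential_comp_D] at h
  exact h

end Lift

variable [PoissonAlgebra k R]

/-- For `a` in the domain, the extension of `{a, -}` to the quotient field; this is a derivation
in `a`. -/
noncomputable def fractionHam :
    Derivation k R (Derivation k (FractionRing R) (FractionRing R)) :=
  Derivation.mk'
    { toFun := fun a => liftDerivation ((Algebra.linearMap R (FractionRing R)).compDer (ham k a))
      map_add' := fun a b => fraction_derivation_ext fun c => by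
        simp [liftDerivation_algebraMap, ham_apply, pb_add_left]
      map_smul' := fun r a => fraction_derivation_ext fun c => by
        simp [liftDerivation_algebraMap, ham_apply, pb_smul_left] }
    fun a b => fraction_derivation_ext fun c => by
      simp [liftDerivation_algebraMap, ham_apply, pb_mul_left, Algebra.smul_def]
      ring

theorem fractionHam_apply (a b : R) :
    fractionHam (k := k) a (algebraMap R (FractionRing R) b) =
      algebraMap R (FractionRing R) (pb k a b) :=
  liftDerivation_algebraMap _ b

/-- The extension of the bracket to the quotient field, as a biderivation. -/
noncomputable def fractionBi :
    Derivation k (FractionRing R) (Derivation k (FractionRing R) (FractionRing R)) :=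
  liftDerivation (fractionHam (k := k) (R := R))

theorem fractionBi_algebraMap (a b : R) :
    fractionBi (k := k) (algebraMap R (FractionRing R) a) (algebraMap R (FractionRing R) b) =
      algebraMap R (FractionRing R) (pb k a b) := by
  rw [fractionBi, liftDerivation_algebraMap, fractionHam_apply]

theorem fractionBi_skew (u v : FractionRing R) :
    fractionBi (k := k) u v = - fractionBi (k := k) v u := by
  -- evaluation at a point, as a linear map on derivations
  let ev : FractionRing R →
      (Derivation k (FractionRing R) (FractionRing R) →ₗ[FractionRing R] FractionRing R) :=
    fun w => { toFun := fun D => D w, map_add' := fun _ _ => rfl, map_smul' := fun _ _ => rfl }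
  have h1 : ∀ (a : R) (v : FractionRing R),
      fractionBi (k := k) (algebraMap R (FractionRing R) a) v =
        - fractionBi (k := k) v (algebraMap R (FractionRing R) a) := by
    intro a v
    have : fractionBi (k := k) (algebraMap R (FractionRing R) a) =
        - (ev (algebraMap R (FractionRing R) a)).compDer (fractionBi (k := k)) := by
      refine fraction_derivation_ext fun b => ?_
      change fractionBi (k := k) (algebraMap R (FractionRing R) a) (algebraMap R _ b) =
        - fractionBi (k := k) (algebraMap R _ b) (algebraMap R (FractionRing R) a)
      rw [fractionBi_algebraMap, fractionBi_algebraMap, pb_skew, map_neg]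
    exact congrArg (fun D => D v) this
  have : fractionBi (k := k) u = - (ev u).compDer (fractionBi (k := k)) := by
    refine fraction_derivation_ext fun b => ?_
    change fractionBi (k := k) u (algebraMap R _ b) = - fractionBi (k := k) (algebraMap R _ b) u
    rw [h1, neg_neg]
  exact congrArg (fun D => D v) this

theorem fractionBi_self (w : FractionRing R) : fractionBi (k := k) w w = 0 := by
  obtain ⟨a, s, hs, rfl⟩ := IsFractionRing.div_surjective (A := R) w
  have hs0 : algebraMap R (FractionRing R) s ≠ 0 :=
    IsFractionRing.to_map_ne_zero_of_mem_nonZeroDivisors hs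
  set S := algebraMap R (FractionRing R) s with hS
  set w := algebraMap R (FractionRing R) a / S with hw
  have ha : algebraMap R (FractionRing R) a = S * w := by rw [hw, mul_div_cancel₀ _ hs0]
  have h1 : fractionBi (k := k) (S * w) (S * w) = 0 := by
    rw [← ha, fractionBi_algebraMap, pb_self, map_zero]
  have h2 : fractionBi (k := k) S S = 0 := by rw [hS, fractionBi_algebraMap, pb_self, map_zero]
  have h3 := fractionBi_skew (k := k) S w
  simp only [Derivation.leibniz, Derivation.add_apply, Derivation.smul_apply, smul_eq_mul, h2,
    h3] at h1
  have h4 : S * S * fractionBi (k := k) w w = 0 := by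
    rw [← h1]; ring
  exact (mul_eq_zero.1 h4).resolve_left (mul_ne_zero hs0 hs0)

theorem fractionBi_jacobi (u v w : FractionRing R) :
    fractionBi (k := k) u (fractionBi (k := k) v w) +
      fractionBi (k := k) v (fractionBi (k := k) w u) +
      fractionBi (k := k) w (fractionBi (k := k) u v) = 0 := by
  have aux : ∀ u v : FractionRing R,
      (∀ c : R, fractionBi (k := k) u (fractionBi (k := k) v (algebraMap R _ c)) +
        fractionBi (k := k) v (fractionBi (k := k) (algebraMap R _ c) u) +
        fractionBi (k := k) (algebraMap R _ c) (fractionBi (k := k) u v) = 0) →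
      ∀ w, fractionBi (k := k) u (fractionBi (k := k) v w) +
        fractionBi (k := k) v (fractionBi (k := k) w u) +
        fractionBi (k := k) w (fractionBi (k := k) u v) = 0 := by
    intro u v h w
    have e : ⁅fractionBi (k := k) u, fractionBi (k := k) v⁆ =
        fractionBi (k := k) (fractionBi (k := k) u v) := by
      refine fraction_derivation_ext fun c => ?_
      have hc := h c
      rw [fractionBi_skew (algebraMap R _ c) u, fractionBi_skew (algebraMap R _ c), map_neg] at hc
      rw [Derivation.commutator_apply]
      linear_combination hc
    have e' := congrArg (fun D => D w) e
    simp only [Derivation.commutator_apply] at e'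
    rw [fractionBi_skew w u, fractionBi_skew w, map_neg]
    linear_combination e'
  have h1 : ∀ (a b : R) (w : FractionRing R), _ := fun a b => aux (algebraMap R _ a)
    (algebraMap R _ b) fun c => by
      simp only [fractionBi_algebraMap, ← map_add, pb_jacobi, map_zero]
  have h2 : ∀ (a : R) (v w : FractionRing R), _ := fun a v => aux (algebraMap R _ a) v fun c => by
    have := h1 c a v
    linear_combination this
  refine aux u v (fun c => ?_) w
  have := h2 c u v
  linear_combination this

/-- The unique extension of a Poisson bracket on a domain to the quotient field. -/
@[reducible] noncomputable def fractionRing (k R : Type*) [Field k] [CommRing R] [IsDomain R]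
    [Algebra k R] [PoissonAlgebra k R] : PoissonAlgebra k (FractionRing R) where
  bracket := LinearMap.mk₂ k (fun u v => fractionBi (k := k) u v)
    (fun u v w => by rw [map_add, Derivation.add_apply])
    (fun r u v => by rw [Derivation.map_smul, Derivation.smul_apply])
    (fun u v w => by rw [map_add])
    (fun r u v => by rw [Derivation.map_smul])
  bracket_self := fun u => fractionBi_self u
  jacobi := fun u v w => fractionBi_jacobi u v w
  leibniz := fun u v w => by
    simp only [LinearMap.mk₂_apply, Derivation.leibniz, smul_eq_mul]; ring

theorem fractionRing_pb_algebraMap (a b : R) :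
    letI := fractionRing k R
    pb k (algebraMap R (FractionRing R) a) (algebraMap R (FractionRing R) b) =
      algebraMap R (FractionRing R) (pb k a b) := fractionBi_algebraMap a b

theorem fractionRing_unique (E : PoissonAlgebra k (FractionRing R))
    (hE : ∀ a b : R, E.bracket (algebraMap R (FractionRing R) a)
      (algebraMap R (FractionRing R) b) = algebraMap R (FractionRing R) (pb k a b))
    (u v : FractionRing R) : E.bracket u v = (fractionRing k R).bracket u v := by
  have step : ∀ w : FractionRing R,
      (∀ b : R, E.bracket w (algebraMap R _ b) = fractionBi (k := k) w (algebraMap R _ b)) →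
      ∀ v, E.bracket w v = fractionBi (k := k) w v := by
    intro w h v
    have : @ham k _ _ _ _ E w = fractionBi (k := k) w := fraction_derivation_ext h
    exact congrArg (fun D => D v) this
  refine step u (fun b => ?_) v
  have h1 := step (algebraMap R _ b) (fun c => by rw [hE, fractionBi_algebraMap]) u
  have h2 := @pb_skew k _ _ _ _ E u (algebraMap R _ b)
  rw [fractionBi_skew, ← h1]
  exact h2

end Fraction

section DixmierMoeglin

variable (k : Type*) {A : Type*} [Field k] [CommRing A] [Algebra k A] [PoissonAlgebra k A]

/-- The field `Z_p(Fract A/P)`: the Poisson center of the quotient field of `A/P`. -/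
noncomputable def fractCenter (P : Ideal A) [P.IsPrime] (hP : IsPoissonIdeal k P) :
    Subalgebra k (FractionRing (A ⧸ P)) :=
  letI : PoissonAlgebra k (A ⧸ P) := quotient hP
  letI : PoissonAlgebra k (FractionRing (A ⧸ P)) := fractionRing k (A ⧸ P)
  center k (FractionRing (A ⧸ P))

/-- A Poisson rational Poisson prime: `Z_p(Fract A/P)` is algebraic over `k`. -/
def IsPoissonRational (P : Ideal A) : Prop :=
  ∃ (_ : P.IsPrime) (hP : IsPoissonIdeal k P), (fractCenter k P hP).IsAlgebraic

/-- The ideal `P` is a Poisson prime and a locally closed point of the Poisson prime spectrum. -/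
def IsLocallyClosedPoint (P : Ideal A) : Prop :=
  ∃ Q : PSpec k A, Q.1.asIdeal = P ∧ IsLocallyClosed ({Q} : Set (PSpec k A))

/-- The Poisson Dixmier-Moeglin equivalence: the Poisson primitive ideals, the locally closed
points of the Poisson prime spectrum and the Poisson rational Poisson primes coincide. -/
def DixmierMoeglin (k A : Type*) [Field k] [CommRing A] [Algebra k A] [PoissonAlgebra k A] :
    Prop :=
  {P : Ideal A | IsPoissonPrimitive k P} = {P : Ideal A | IsLocallyClosedPoint k P} ∧
    {P : Ideal A | IsLocallyClosedPoint k P} = {P : Ideal A | IsPoissonRational k P}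

end DixmierMoeglin

end PoissonAlgebra

namespace TorusAction

variable {k A : Type*} [Field k] [CommRing A] [Algebra k A] {r : ℕ}

/-- The rational character `h ↦ h₁ ^ m₁ ⋯ h_r ^ m_r` of the torus `(k^×)^r`. -/
def character (k : Type*) [Field k] {r : ℕ} (m : Fin r → ℤ) : (Fin r → kˣ) →* kˣ where
  toFun h := ∏ l, h l ^ m l
  map_one' := by simp
  map_mul' g h := by simp [mul_zpow, Finset.prod_mul_distrib]

/-- The eigenspace `A_m` of the character `m`. -/
def weightSpace (ρ : (Fin r → kˣ) →* (A ≃ₐ[k] A)) (m : Fin r → ℤ) : Submodule k A where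
  carrier := {a | ∀ h, ρ h a = (character k m h : k) • a}
  add_mem' := fun {a b} ha hb h => by rw [map_add, ha h, hb h, smul_add]
  zero_mem' := fun h => by simp
  smul_mem' := fun c a ha h => by rw [map_smul, ha h, smul_comm]

/-- An action of the torus `(k^×)^r` on `A` by algebra automorphisms is rational if `A` is
generated as an algebra by eigenvectors whose eigenvalues are rational characters. -/
def IsRational (ρ : (Fin r → kˣ) →* (A ≃ₐ[k] A)) : Prop :=
  Algebra.adjoin k {a : A | ∃ m : Fin r → ℤ, a ∈ weightSpace ρ m} = ⊤

/-- The action is by Poisson automorphisms. -/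
def IsPoisson [PoissonAlgebra k A] (ρ : (Fin r → kˣ) →* (A ≃ₐ[k] A)) : Prop :=
  ∀ h a b, ρ h (PoissonAlgebra.pb k a b) = PoissonAlgebra.pb k (ρ h a) (ρ h b)

/-- An `H`-eigenvector: an element which is an eigenvector of every element of `H`. -/
def IsEigenvector (ρ : (Fin r → kˣ) →* (A ≃ₐ[k] A)) (x : A) : Prop :=
  ∀ h, ∃ c : k, Module.End.HasEigenvector (ρ h).toLinearMap c x

/-- An ideal `I` is `H`-stable if `h(I) ⊆ I` for all `h ∈ H`. -/
def IsStable (ρ : (Fin r → kˣ) →* (A ≃ₐ[k] A)) (I : Ideal A) : Prop :=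
  ∀ h, ∀ a ∈ I, ρ h a ∈ I

theorem weightSpace_mul_mem (ρ : (Fin r → kˣ) →* (A ≃ₐ[k] A)) {m m' : Fin r → ℤ} {a b : A}
    (ha : a ∈ weightSpace ρ m) (hb : b ∈ weightSpace ρ m') :
    a * b ∈ weightSpace ρ (m + m') := by
  intro h
  have e : character k (m + m') h = character k m h * character k m' h := by
    simp [character, zpow_add, Finset.prod_mul_distrib]
  rw [map_mul, ha h, hb h, e, Units.val_mul, smul_mul_smul_comm]

theorem one_mem_weightSpace (ρ : (Fin r → kˣ) →* (A ≃ₐ[k] A)) :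
    (1 : A) ∈ weightSpace ρ 0 := fun h => by simp [character]

theorem iSup_weightSpace {ρ : (Fin r → kˣ) →* (A ≃ₐ[k] A)} (hρ : IsRational ρ) :
    ⨆ m, weightSpace ρ m = ⊤ := by
  rw [eq_top_iff]
  intro a _
  have ha : a ∈ Algebra.adjoin k {a : A | ∃ m : Fin r → ℤ, a ∈ weightSpace ρ m} := by
    rw [hρ]; trivial
  induction ha using Algebra.adjoin_induction with
  | mem x hx =>
    obtain ⟨m, hm⟩ := hx
    exact Submodule.mem_iSup_of_mem m hm
  | algebraMap c =>
    rw [Algebra.algebraMap_eq_smul_one]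
    exact Submodule.mem_iSup_of_mem 0 (Submodule.smul_mem _ c (one_mem_weightSpace ρ))
  | add x y _ _ hx hy => exact add_mem (hx trivial) (hy trivial)
  | mul x y _ _ hx hy =>
    refine Submodule.iSup_induction _ (motive := fun x => x * y ∈ _) (hx trivial) ?_ ?_ ?_
    · intro m x hx
      refine Submodule.iSup_induction _ (motive := fun y => x * y ∈ _) (hy trivial) ?_ ?_ ?_
      · intro m' y hy
        exact Submodule.mem_iSup_of_mem (m + m') (weightSpace_mul_mem ρ hx hy)
      · simp
      · intro y z hy hz
        rw [mul_add]; exact add_mem hy hz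
    · simp
    · intro x z hx hz
      rw [add_mul]; exact add_mem hx hz

theorem character_injective (k : Type*) [Field k] [CharZero k] {r : ℕ} :
    Function.Injective fun (m : Fin r → ℤ) (h : Fin r → kˣ) => (character k m h : k) := by
  intro m m' e
  ext l
  have h2 : (2 : k) ≠ 0 := two_ne_zero
  have e' := congrFun e (Pi.mulSingle l (Units.mk0 (2 : k) h2))
  have key : ∀ n : Fin r → ℤ,
      character k n (Pi.mulSingle l (Units.mk0 (2 : k) h2)) = Units.mk0 (2 : k) h2 ^ n l := by
    intro n
    change ∏ j : Fin r, (Pi.mulSingle l (Units.mk0 (2 : k) h2) : Fin r → kˣ) j ^ n j = _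
    rw [Finset.prod_eq_single l]
    · simp
    · intro j _ hj
      simp [Pi.mulSingle_eq_of_ne hj]
    · simp
  simp only [key, Units.val_zpow_eq_zpow_val, Units.val_mk0] at e'
  have e'' : (2 : ℚ) ^ m l = (2 : ℚ) ^ m' l := by
    have : ((((2 : ℚ) ^ m l : ℚ)) : k) = (((2 : ℚ) ^ m' l : ℚ) : k) := by
      push_cast; exact e'
    exact_mod_cast this
  exact zpow_right_injective₀ (by norm_num) (by norm_num) e''

theorem iSupIndep_weightSpace [CharZero k] (ρ : (Fin r → kˣ) →* (A ≃ₐ[k] A)) :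
    iSupIndep (weightSpace ρ) := by
  have h1 := Module.End.independent_iInf_maxGenEigenspace_of_forall_mapsTo
    (fun h : Fin r → kˣ => ((ρ h).toLinearMap : Module.End k A)) (fun i j φ => by
      refine Module.End.mapsTo_maxGenEigenspace_of_comm ?_ φ
      change (ρ j).toLinearMap ∘ₗ (ρ i).toLinearMap = (ρ i).toLinearMap ∘ₗ (ρ j).toLinearMap
      ext a
      change (ρ j * ρ i) a = (ρ i * ρ j) a
      rw [← map_mul, ← map_mul, mul_comm])
  refine (h1.comp (character_injective k (r := r))).mono fun m a ha => ?_
  simp only [Function.comp, Submodule.mem_iInf]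
  intro h
  refine Module.End.mem_maxGenEigenspace _ _ _ |>.2 ⟨1, ?_⟩
  simp [ha h]

theorem isInternal_weightSpace [CharZero k] {ρ : (Fin r → kˣ) →* (A ≃ₐ[k] A)}
    (hρ : IsRational ρ) : DirectSum.IsInternal (weightSpace ρ) :=
  DirectSum.isInternal_submodule_of_iSupIndep_of_iSup_eq_top (iSupIndep_weightSpace ρ)
    (iSup_weightSpace hρ)

/-- The differential of a rational action of `H = (k^×)^r`: the element `η` of
`Lie H = k^r` acts on `A = ⨁ A_m` as multiplication by `(η | m) = η₁ m₁ + ⋯ + η_r m_r`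
on the eigenspace `A_m`. -/
noncomputable def differential [CharZero k] {ρ : (Fin r → kˣ) →* (A ≃ₐ[k] A)}
    (hρ : IsRational ρ) (η : Fin r → k) : Module.End k A :=
  DirectSum.toModule k (Fin r → ℤ) A
      (fun m => (∑ l, η l * (m l : k)) • (weightSpace ρ m).subtype) ∘ₗ
    (LinearEquiv.ofBijective (DirectSum.coeLinearMap (weightSpace ρ))
      (isInternal_weightSpace hρ)).symm.toLinearMap

theorem differential_apply [CharZero k] {ρ : (Fin r → kˣ) →* (A ≃ₐ[k] A)}
    (hρ : IsRational ρ) (η : Fin r → k) {m : Fin r → ℤ} {a : A} (ha : a ∈ weightSpace ρ m) :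
    differential hρ η a = (∑ l, η l * (m l : k)) • a := by
  have e : (LinearEquiv.ofBijective (DirectSum.coeLinearMap (weightSpace ρ))
      (isInternal_weightSpace hρ)).symm a =
      DirectSum.lof k (Fin r → ℤ) (fun m => weightSpace ρ m) m ⟨a, ha⟩ := by
    rw [LinearEquiv.symm_apply_eq]
    exact (DirectSum.coeLinearMap_lof (weightSpace ρ) m ⟨a, ha⟩).symm
  change DirectSum.toModule k (Fin r → ℤ) A _ _ = _
  rw [LinearEquiv.coe_coe, e, DirectSum.toModule_lof]
  rfl

end TorusAction

/-!
**Counting.** Let `R` be the subalgebra generated by `x₁, …, x_{i-1}`, let `P` be an `H`-stable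
Poisson prime with residue map `φ : A → L = Fract (A / P)`, and let `K` be the subfield of `L`
generated by `φ(R)`. For `x = φ(xᵢ)` and `r ∈ K` we have `{x, r} = η(r) x + δ(r)` with `δ(r) ∈ K`,
and `η(x) = c x` with `c ≠ 0`. If `x` is algebraic over `K`, the mean `y ∈ K` of its conjugates
satisfies the same equations, so `w = x - y` satisfies `{w, r} = η(r) w` for `r ∈ K`. Then
`{w, -} - w η` vanishes on `K`, hence at `w`, which gives `c w² = 0` and `x = y ∈ K`. So `x` is
either transcendental over `K` or an element of `K`, in which case the equations determine it
uniquely; either way `P ∩ R` determines `P ∩ R[xᵢ]`. Hence `P` is determined by the set of those `i`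
for which `x` lies in `K`.

**Equivalence.** A locally closed point `P` is the Poisson core of any maximal ideal `M ⊇ P`
avoiding a suitable element, and such `M` exist by the Nullstellensatz. The Poisson centre of
`Fract (A / P)` for the Poisson core `P` of `M` lies in the localization of `A / P` at `M`, hence
embeds into the finite extension `A / M` of `k`. Finally, if `P` is rational and `Q ⊇ P` is a
Poisson prime whose weight vectors all lie in `P`, then `Q = P`, because Wronskians shorten a sum
of weight vectors in `Q`. The weight vectors of `Q` generate an `H`-stable Poisson prime, and there
are only finitely many of these, so `P` is locally closed.
-/

theorem isPrime_span_homogeneous {ι k A : Type*} [AddCommMonoid ι] [LinearOrder ι]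
    [IsOrderedCancelAddMonoid ι] [CommRing k] [CommRing A] [Algebra k A] (𝒜 : ι → Submodule k A)
    [SetLike.GradedMonoid 𝒜] (hind : iSupIndep 𝒜) (hsup : ⨆ i, 𝒜 i = ⊤) {P : Ideal A}
    (hP : P.IsPrime) : (Ideal.span {a | (∃ i, a ∈ 𝒜 i) ∧ a ∈ P}).IsPrime := by
  classical
  let _ : DirectSum.Decomposition 𝒜 :=
    (DirectSum.isInternal_submodule_of_iSupIndep_of_iSup_eq_top hind hsup).chooseDecomposition
  let _ : GradedAlgebra 𝒜 := { }
  have hcore : (P.homogeneousCore 𝒜).toIdeal = Ideal.span {a | (∃ i, a ∈ 𝒜 i) ∧ a ∈ P} :=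
    congrArg Ideal.span (Subtype.image_preimage_coe {a | SetLike.IsHomogeneousElem 𝒜 a} P)
  exact hcore ▸ hP.homogeneousCore

namespace TorusAction

variable {k A : Type*} [Field k] [CommRing A] [Algebra k A] {r : ℕ}
  {ρ : (Fin r → kˣ) →* (A ≃ₐ[k] A)}

theorem pb_mem_weightSpace [PoissonAlgebra k A] (hpois : IsPoisson ρ) {m m' : Fin r → ℤ} {a b : A}
    (ha : a ∈ weightSpace ρ m) (hb : b ∈ weightSpace ρ m') :
    PoissonAlgebra.pb k a b ∈ weightSpace ρ (m + m') := by
  intro h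
  have hmul : character k (m + m') h = character k m h * character k m' h := by
    simp [character, zpow_add, Finset.prod_mul_distrib]
  rw [hpois, ha h, hb h, hmul, Units.val_mul, PoissonAlgebra.pb_smul_left,
    PoissonAlgebra.pb_smul_right, smul_smul]

theorem weight_induction (hrat : IsRational ρ) {motive : A → Prop}
    (weight : ∀ m, ∀ a ∈ weightSpace ρ m, motive a)
    (add : ∀ a b, motive a → motive b → motive (a + b)) (a : A) : motive a :=
  Submodule.iSup_induction (weightSpace ρ) (motive := motive)
    (iSup_weightSpace hrat ▸ Submodule.mem_top) weight (weight 0 0 (zero_mem _)) add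

theorem exists_sum_eq (hrat : IsRational ρ) (a : A) :
    ∃ (s : Finset (Fin r → ℤ)) (c : (Fin r → ℤ) → A),
      (∀ m, c m ∈ weightSpace ρ m) ∧ a = ∑ m ∈ s, c m := by
  have ha : a ∈ ⨆ m, weightSpace ρ m := iSup_weightSpace hrat ▸ Submodule.mem_top
  obtain ⟨f, hf, rfl⟩ := (Submodule.mem_iSup_iff_exists_finsupp _ _).1 ha
  exact ⟨f.support, f, hf, rfl⟩

theorem linearIndependent_character (k : Type*) [Field k] [CharZero k] (r : ℕ) :
    LinearIndependent k fun (m : Fin r → ℤ) (h : Fin r → kˣ) => (character k m h : k) :=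
  (linearIndependent_monoidHom (Fin r → kˣ) k).comp
    (fun m => (Units.coeHom k).comp (character k m))
    fun _ _ h => character_injective k (congrArg DFunLike.coe h)

section Differential

variable [CharZero k]

/- A functional vanishing on `W` turns the orbit of `∑ m ∈ s, a m` into a linear relation between
the characters. -/
theorem mem_of_sum_mem {W : Submodule k A} (hW : ∀ h, ∀ a ∈ W, ρ h a ∈ W)
    {s : Finset (Fin r → ℤ)} {a : (Fin r → ℤ) → A} (ha : ∀ m ∈ s, a m ∈ weightSpace ρ m)
    (hs : ∑ m ∈ s, a m ∈ W) {m : Fin r → ℤ} (hm : m ∈ s) : a m ∈ W := by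
  by_contra hmW
  obtain ⟨f, hfm, hfW⟩ := Submodule.exists_le_ker_of_notMem hmW
  have hrel : ∑ m ∈ s, f (a m) • (fun h => (character k m h : k)) = 0 := by
    ext h
    have horbit : f (ρ h (∑ m ∈ s, a m)) = 0 := hfW (hW h _ hs)
    rw [map_sum, map_sum] at horbit
    rw [Finset.sum_apply, Pi.zero_apply, ← horbit]
    refine Finset.sum_congr rfl fun m hm => ?_
    rw [ha m hm h, map_smul, Pi.smul_apply, smul_eq_mul, smul_eq_mul, mul_comm]
  exact hfm (linearIndependent_iff'.1 (linearIndependent_character k r) s _ hrel m hm)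

theorem differential_mul (hrat : IsRational ρ) (η : Fin r → k) (a b : A) :
    differential hrat η (a * b) = a * differential hrat η b + b * differential hrat η a := by
  induction a using weight_induction hrat with
  | add a a' ha ha' => simp only [add_mul, mul_add, map_add, ha, ha']; abel
  | weight m a ha =>
    induction b using weight_induction hrat with
    | add b b' hb hb' => simp only [add_mul, mul_add, map_add, hb, hb']; abel
    | weight m' b hb =>
      rw [differential_apply hrat η (weightSpace_mul_mem ρ ha hb), differential_apply hrat η ha,
        differential_apply hrat η hb]
      simp only [Pi.add_apply, Int.cast_add, mul_add, Finset.sum_add_distrib, add_smul,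
        mul_smul_comm, mul_comm b a]
      rw [add_comm]

/-- The differential of a rational torus action as a derivation. -/
noncomputable def differentialDer (hrat : IsRational ρ) (η : Fin r → k) : Derivation k A A :=
  Derivation.mk' (differential hrat η) (differential_mul hrat η)

theorem IsStable.differential_mem {I : Ideal A} (hI : IsStable ρ I) (hrat : IsRational ρ)
    (η : Fin r → k) {a : A} (ha : a ∈ I) : differential hrat η a ∈ I := by
  obtain ⟨s, c, hc, rfl⟩ := exists_sum_eq hrat a
  rw [map_sum]
  refine sum_mem fun m hm => ?_
  rw [differential_apply hrat η (hc m)]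
  exact (I.restrictScalars k).smul_mem _
    (mem_of_sum_mem (W := I.restrictScalars k) hI (fun m _ => hc m) ha hm)

theorem IsEigenvector.exists_mem_weightSpace (hrat : IsRational ρ) {x : A}
    (hx : IsEigenvector ρ x) : ∃ m, x ∈ weightSpace ρ m := by
  obtain ⟨s, c, hc, hxs⟩ := exists_sum_eq hrat x
  have hspan : ∀ h, ∀ a ∈ Submodule.span k {x}, ρ h a ∈ Submodule.span k {x} := by
    intro h a ha
    obtain ⟨t, rfl⟩ := Submodule.mem_span_singleton.1 ha
    obtain ⟨d, hd⟩ := hx h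
    have hρx : ρ h x = d • x := hd.apply_eq_smul
    rw [map_smul, hρx, smul_smul]
    exact Submodule.smul_mem _ _ (Submodule.mem_span_singleton_self x)
  obtain ⟨m, hm, hm0⟩ : ∃ m ∈ s, c m ≠ 0 :=
    Finset.exists_ne_zero_of_sum_ne_zero (hxs ▸ (hx 1).choose_spec.2)
  obtain ⟨t, ht⟩ := Submodule.mem_span_singleton.1 <|
    mem_of_sum_mem hspan (fun m _ => hc m) (hxs ▸ Submodule.mem_span_singleton_self x) hm
  have ht0 : t ≠ 0 := by
    rintro rfl
    exact hm0 (by rw [← ht, zero_smul])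
  exact ⟨m, ((weightSpace ρ m).smul_mem_iff ht0).1 (ht ▸ hc m)⟩

end Differential

section StablePoissonPrime

/-- The ideal generated by the weight vectors in `P`. -/
def weightCore (ρ : (Fin r → kˣ) →* (A ≃ₐ[k] A)) (P : Ideal A) : Ideal A :=
  Ideal.span {a | (∃ m, a ∈ weightSpace ρ m) ∧ a ∈ P}

theorem weightCore_le (P : Ideal A) : weightCore ρ P ≤ P :=
  Ideal.span_le.2 fun _ ha => ha.2

theorem mem_weightCore {P : Ideal A} {m : Fin r → ℤ} {a : A} (ha : a ∈ weightSpace ρ m)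
    (haP : a ∈ P) : a ∈ weightCore ρ P :=
  Ideal.subset_span ⟨⟨m, ha⟩, haP⟩

theorem isStable_weightCore (P : Ideal A) : IsStable ρ (weightCore ρ P) := by
  intro h
  refine (Ideal.span_le (I := (weightCore ρ P).comap (ρ h).toRingHom)).2 ?_
  rintro a ⟨⟨m, ha⟩, haP⟩
  change ρ h a ∈ weightCore ρ P
  rw [ha h]
  exact ((weightCore ρ P).restrictScalars k).smul_mem _ (mem_weightCore ha haP)

theorem weightCore_isPrime [CharZero k] (hrat : IsRational ρ) {P : Ideal A} (hP : P.IsPrime) :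
    (weightCore ρ P).IsPrime := by
  -- The lexicographic order makes the group of characters a linearly ordered group.
  have : SetLike.GradedMonoid fun m : Lex (Fin r → ℤ) => weightSpace ρ (ofLex m) :=
    { one_mem := one_mem_weightSpace ρ
      mul_mem := fun _ _ _ _ => weightSpace_mul_mem ρ }
  exact isPrime_span_homogeneous (fun m : Lex (Fin r → ℤ) => weightSpace ρ (ofLex m))
    (iSupIndep_weightSpace ρ) (iSup_weightSpace hrat) hP

theorem weightCore_isPoissonIdeal [PoissonAlgebra k A] (hrat : IsRational ρ)
    (hpois : IsPoisson ρ) {P : Ideal A} (hP : PoissonAlgebra.IsPoissonIdeal k P) :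
    PoissonAlgebra.IsPoissonIdeal k (weightCore ρ P) := by
  intro a b hb
  induction hb using Submodule.span_induction with
  | zero => simp [PoissonAlgebra.pb]
  | add b b' _ _ hb hb' => rw [PoissonAlgebra.pb_add_right]; exact add_mem hb hb'
  | smul c b hbmem hb =>
    rw [smul_eq_mul, PoissonAlgebra.pb_mul_right]
    exact add_mem (Ideal.mul_mem_left _ _ hbmem) (Ideal.mul_mem_left _ _ hb)
  | mem b hb =>
    obtain ⟨⟨m, hbm⟩, hbP⟩ := hb
    induction a using weight_induction hrat with
    | add a a' ha ha' => rw [PoissonAlgebra.pb_add_left]; exact add_mem ha ha'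
    | weight m' a ha => exact mem_weightCore (pb_mem_weightSpace hpois ha hbm) (hP a b hbP)

end StablePoissonPrime

end TorusAction

namespace PoissonAlgebra

section DerivationCore

variable {k A : Type*} [Field k] [CommRing A] [Algebra k A]

theorem derivation_iterate_mul (D : Derivation k A A) (n : ℕ) (a b : A) :
    D^[n] (a * b) = ∑ ij ∈ Finset.HasAntidiagonal.antidiagonal n,
      n.choose ij.1 • (D^[ij.1] a * D^[ij.2] b) := by
  induction n with
  | zero => simp
  | succ n ih =>
    rw [Finset.sum_antidiagonal_choose_succ_nsmul (M := A) fun i j => D^[i] a * D^[j] b]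
    simp only [Function.iterate_succ_apply', ih, map_sum, map_nsmul, Derivation.leibniz,
      smul_add, Finset.sum_add_distrib, smul_eq_mul]
    congr 1
    refine Finset.sum_congr rfl fun ij hij => ?_
    rw [mul_comm, n.choose_symm_of_eq_add (Finset.HasAntidiagonal.mem_antidiagonal.1 hij).symm]

variable [CharZero k]

/-- The flow of a derivation: the ring homomorphism `a ↦ exp (X D) a = ∑ n, Dⁿ a / n! Xⁿ`. -/
noncomputable def taylor (D : Derivation k A A) : A →+* PowerSeries A where
  toFun a := PowerSeries.mk fun n => (n.factorial : k)⁻¹ • D^[n] a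
  map_one' := by
    ext (_ | n)
    · simp
    · simp [PowerSeries.coeff_one]
  map_zero' := by ext n; simp [iterate_map_zero]
  map_add' a b := by ext n; simp [iterate_map_add]
  map_mul' a b := by
    ext n
    rw [PowerSeries.coeff_mul, PowerSeries.coeff_mk, derivation_iterate_mul, Finset.smul_sum]
    refine Finset.sum_congr rfl fun ij hij => ?_
    obtain ⟨i, j⟩ := ij
    obtain rfl := Finset.HasAntidiagonal.mem_antidiagonal.1 hij
    rw [PowerSeries.coeff_mk, PowerSeries.coeff_mk, smul_mul_smul_comm, ← Nat.cast_smul_eq_nsmul k,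
      smul_smul, Nat.cast_add_choose]
    congr 1
    field_simp [Nat.factorial_ne_zero]

theorem coeff_taylor (D : Derivation k A A) (a : A) (n : ℕ) :
    PowerSeries.coeff n (taylor D a) = (n.factorial : k)⁻¹ • D^[n] a :=
  PowerSeries.coeff_mk n fun n => (n.factorial : k)⁻¹ • D^[n] a

/-- The largest ideal contained in `P` and stable under the derivation `D`, encoded as the kernel
of the reduction modulo `P` of the flow of `D`. -/
noncomputable def derivationCore (D : Derivation k A A) (P : Ideal A) : Ideal A :=
  RingHom.ker ((PowerSeries.map (Ideal.Quotient.mk P)).comp (taylor D))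

theorem mem_derivationCore {D : Derivation k A A} {P : Ideal A} {a : A} :
    a ∈ derivationCore D P ↔ ∀ n : ℕ, D^[n] a ∈ P := by
  rw [derivationCore, RingHom.mem_ker, PowerSeries.ext_iff]
  refine forall_congr' fun n => ?_
  have hn : ((n.factorial : k)⁻¹) ≠ 0 := inv_ne_zero (Nat.cast_ne_zero.2 n.factorial_ne_zero)
  rw [RingHom.comp_apply, PowerSeries.coeff_map, coeff_taylor, map_zero,
    Ideal.Quotient.eq_zero_iff_mem]
  exact (P.restrictScalars k).smul_mem_iff hn

theorem derivationCore_isPrime (D : Derivation k A A) (P : Ideal A) [P.IsPrime] :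
    (derivationCore D P).IsPrime :=
  RingHom.ker_isPrime _

theorem derivation_mem_of_mem_minimalPrimes (D : Derivation k A A) {I P : Ideal A}
    (hI : ∀ a ∈ I, D a ∈ I) (hP : P ∈ I.minimalPrimes) {a : A} (ha : a ∈ P) : D a ∈ P := by
  have hIcore : I ≤ derivationCore D P := fun b hb =>
    mem_derivationCore.2 fun n => hP.1.2 (Set.MapsTo.iterate (s := (I : Set A)) hI n hb)
  have hcoreP : derivationCore D P ≤ P := fun b hb => mem_derivationCore.1 hb 0
  have := hP.1.1
  exact mem_derivationCore.1 (hP.2 ⟨derivationCore_isPrime D P, hIcore⟩ hcoreP ha) 1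

end DerivationCore

section Core

variable {k A : Type*} [Field k] [CommRing A] [Algebra k A] [PoissonAlgebra k A]

theorem core_isPoissonIdeal (J : Ideal A) : IsPoissonIdeal k (core k J) :=
  (isGreatest_core k J).1.1

theorem core_le (J : Ideal A) : core k J ≤ J := (isGreatest_core k J).1.2

theorem le_core {I J : Ideal A} (hI : IsPoissonIdeal k I) (h : I ≤ J) : I ≤ core k J :=
  (isGreatest_core k J).2 ⟨hI, h⟩

theorem core_isPoissonPrime [CharZero k] {M : Ideal A} (hM : M.IsPrime) :
    IsPoissonPrime k (core k M) := by
  obtain ⟨P, hP, hPM⟩ := Ideal.exists_minimalPrimes_le (core_le (k := k) M)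
  have hPoisson : IsPoissonIdeal k P := fun a _ hb =>
    derivation_mem_of_mem_minimalPrimes (ham k a) (core_isPoissonIdeal M a) hP hb
  have hcore : core k M = P := le_antisymm hP.1.2 (le_core hPoisson hPM)
  exact hcore ▸ ⟨hP.1.1, hPoisson⟩

end Core

section LocallyClosed

variable {k A : Type*} [Field k] [CommRing A] [Algebra k A] [PoissonAlgebra k A]

theorem isLocallyClosedPoint_iff {P : Ideal A} : IsLocallyClosedPoint k P ↔
    IsPoissonPrime k P ∧ ∃ f ∉ P, ∀ Q, IsPoissonPrime k Q → P ≤ Q → f ∉ Q → Q = P := by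
  constructor
  · rintro ⟨P, rfl, U, Z, hU, hZ, hUZ⟩
    refine ⟨⟨P.1.2, P.2⟩, ?_⟩
    have hP : P ∈ U ∩ Z := hUZ ▸ Set.mem_singleton P
    obtain ⟨V, hV, rfl⟩ := isOpen_induced_iff.1 hU
    obtain ⟨T, hT, rfl⟩ := isClosed_induced_iff.1 hZ
    obtain ⟨_, ⟨f, rfl⟩, hf, hfV⟩ :=
      PrimeSpectrum.isTopologicalBasis_basic_opens.exists_subset_of_mem_open hP.1 hV
    refine ⟨f, hf, fun Q hQ hPQ hfQ => ?_⟩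
    have hQT : (⟨Q, hQ.1⟩ : PrimeSpectrum A) ∈ T :=
      ((PrimeSpectrum.le_iff_specializes P.1 ⟨Q, hQ.1⟩).1 hPQ).mem_closed hT hP.2
    have hQP : (⟨⟨Q, hQ.1⟩, hQ.2⟩ : PSpec k A) ∈ ({P} : Set (PSpec k A)) := hUZ ▸ ⟨hfV hfQ, hQT⟩
    exact congrArg (fun R : PSpec k A => R.1.asIdeal) hQP
  · rintro ⟨hP, f, hf, h⟩
    refine ⟨⟨⟨P, hP.1⟩, hP.2⟩, rfl, Subtype.val ⁻¹' PrimeSpectrum.basicOpen f,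
      Subtype.val ⁻¹' PrimeSpectrum.zeroLocus P,
      (PrimeSpectrum.basicOpen f).isOpen.preimage continuous_subtype_val,
      (PrimeSpectrum.isClosed_zeroLocus _).preimage continuous_subtype_val, ?_⟩
    ext Q
    constructor
    · rintro rfl
      exact ⟨hf, fun _ h => h⟩
    · rintro ⟨hfQ, hPQ⟩
      exact Subtype.ext (PrimeSpectrum.ext (h _ ⟨Q.1.2, Q.2⟩ hPQ hfQ))

theorem IsLocallyClosedPoint.isPoissonPrimitive [CharZero k] [Algebra.FiniteType k A] {P : Ideal A}
    (hP : IsLocallyClosedPoint k P) : IsPoissonPrimitive k P := by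
  obtain ⟨⟨hprime, hpoisson⟩, f, hf, hmin⟩ := isLocallyClosedPoint_iff.1 hP
  have : IsJacobsonRing A := isJacobsonRing_of_finiteType (A := k)
  have hfJ : f ∉ P.jacobson := by rwa [IsJacobsonRing.out inferInstance hprime.isRadical]
  obtain ⟨M, hPM, hM, hfM⟩ : ∃ M, P ≤ M ∧ M.IsMaximal ∧ f ∉ M := by
    simpa [Ideal.jacobson, Submodule.mem_sInf] using hfJ
  exact ⟨M, hM, (hmin _ (core_isPoissonPrime hM.isPrime) (le_core hpoisson hPM)
    fun hfcore => hfM (core_le M hfcore)).symm⟩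

end LocallyClosed

end PoissonAlgebra

section LocalRing

variable {k O L : Type*} [Field k] [CommRing O] [IsLocalRing O] [Field L] [Algebra k O]
  [Algebra k L]

open IsLocalRing in
theorem map_eq_zero_of_inv_mem_range (ψ : O →ₐ[k] L) {w : O} (hw : w ∈ maximalIdeal O)
    (hinv : (ψ w)⁻¹ ∈ ψ.range) : ψ w = 0 := by
  by_contra hψw
  obtain ⟨v, hv⟩ := hinv
  have hunit : IsUnit (1 - w * v) :=
    isUnit_one_sub_self_of_mem_nonunits _ ((mem_maximalIdeal _).1 (Ideal.mul_mem_right v _ hw))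
  have hzero : ψ (1 - w * v) = 0 := by
    rw [map_sub, map_one, map_mul, show ψ v = (ψ w)⁻¹ from hv, mul_inv_cancel₀ hψw, sub_self]
  exact (hunit.map ψ).ne_zero hzero

theorem isAlgebraic_of_le_range [Algebra.IsAlgebraic k (IsLocalRing.ResidueField O)]
    (ψ : O →ₐ[k] L) {Z : Subalgebra k L} (hinv : ∀ z ∈ Z, z⁻¹ ∈ Z) (hZ : Z ≤ ψ.range) :
    Z.IsAlgebraic := by
  intro z hz
  obtain ⟨w, rfl⟩ := hZ hz
  obtain ⟨p, hp, hpw⟩ := Algebra.IsAlgebraic.isAlgebraic (R := k) (IsLocalRing.residue O w)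
  have hmax : Polynomial.aeval w p ∈ IsLocalRing.maximalIdeal O := by
    rw [← IsLocalRing.residue_eq_zero_iff, ← hpw]
    exact (Polynomial.aeval_algHom_apply (IsScalarTower.toAlgHom k O _) w p).symm
  have hpz : ψ (Polynomial.aeval w p) ∈ Z :=
    Polynomial.aeval_algHom_apply ψ w p ▸
      Algebra.adjoin_singleton_le hz (Polynomial.aeval_mem_adjoin_singleton k _)
  refine ⟨p, hp, ?_⟩
  exact (Polynomial.aeval_algHom_apply ψ w p).trans
    (map_eq_zero_of_inv_mem_range ψ hmax (hZ (hinv _ hpz)))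

end LocalRing

namespace PoissonAlgebra

section ResidueField

variable {k A : Type*} [Field k] [CommRing A] [Algebra k A]

/-- The canonical map to the residue field `Fract (A / P)` of a prime ideal `P`. -/
def residueMap (k : Type*) {A : Type*} [Field k] [CommRing A] [Algebra k A] (P : Ideal A)
    [P.IsPrime] : A →ₐ[k] FractionRing (A ⧸ P) :=
  (IsScalarTower.toAlgHom k (A ⧸ P) (FractionRing (A ⧸ P))).comp (Ideal.Quotient.mkₐ k P)

variable {P : Ideal A} [P.IsPrime]

theorem residueMap_eq_zero {a : A} : residueMap k P a = 0 ↔ a ∈ P :=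
  (map_eq_zero_iff _ (IsFractionRing.injective (A ⧸ P) (FractionRing (A ⧸ P)))).trans
    Ideal.Quotient.eq_zero_iff_mem

theorem exists_residueMap_mul_eq (z : FractionRing (A ⧸ P)) :
    ∃ s ∉ P, ∃ a, residueMap k P s * z = residueMap k P a := by
  obtain ⟨a, s, hs, rfl⟩ := IsFractionRing.div_surjective (A := A ⧸ P) z
  obtain ⟨a, rfl⟩ := Ideal.Quotient.mk_surjective a
  obtain ⟨s, rfl⟩ := Ideal.Quotient.mk_surjective s
  have hs0 := IsFractionRing.to_map_ne_zero_of_mem_nonZeroDivisors (K := FractionRing (A ⧸ P)) hs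
  exact ⟨s, fun hsP => hs0 (residueMap_eq_zero (k := k).2 hsP), a, mul_div_cancel₀ _ hs0⟩

theorem residueField_derivation_ext {D₁ D₂ : Derivation k (FractionRing (A ⧸ P))
    (FractionRing (A ⧸ P))} (h : ∀ a, D₁ (residueMap k P a) = D₂ (residueMap k P a)) : D₁ = D₂ :=
  fraction_derivation_ext fun b => by
    obtain ⟨a, rfl⟩ := Ideal.Quotient.mk_surjective b
    exact h a

/-- The derivation of the residue field of `P` induced by a derivation stabilising `P`. -/
noncomputable def residueDerivation (D : Derivation k A A) (hD : ∀ a ∈ P, D a ∈ P) :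
    Derivation k (FractionRing (A ⧸ P)) (FractionRing (A ⧸ P)) :=
  liftDerivation <| (Algebra.linearMap (A ⧸ P) (FractionRing (A ⧸ P))).compDer <|
    Derivation.liftOfSurjective (f := Ideal.Quotient.mkₐ k P) Ideal.Quotient.mk_surjective
      (d := D) fun a ha =>
        Ideal.Quotient.eq_zero_iff_mem.2 (hD a (Ideal.Quotient.eq_zero_iff_mem.1 ha))

theorem residueDerivation_residueMap (D : Derivation k A A) (hD : ∀ a ∈ P, D a ∈ P) (a : A) :
    residueDerivation D hD (residueMap k P a) = residueMap k P (D a) := by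
  refine (liftDerivation_algebraMap _ (Ideal.Quotient.mk P a)).trans ?_
  exact congrArg (algebraMap (A ⧸ P) (FractionRing (A ⧸ P)))
    (Derivation.liftOfSurjective_apply (f := Ideal.Quotient.mkₐ k P) _ _ a)

/-- The homomorphism `A_M → Fract (A / P)` for prime ideals `P ⊆ M`. -/
noncomputable def localizationToResidueField {M : Ideal A} [M.IsPrime] (h : P ≤ M) :
    Localization.AtPrime M →ₐ[k] FractionRing (A ⧸ P) :=
  IsLocalization.liftAlgHom (M := M.primeCompl) (f := residueMap k P) fun s =>
    isUnit_iff_ne_zero.2 fun hs => s.2 (h (residueMap_eq_zero.1 hs))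

theorem localizationToResidueField_mk' {M : Ideal A} [M.IsPrime] (h : P ≤ M) {a : A}
    {s : M.primeCompl} {z : FractionRing (A ⧸ P)}
    (hz : residueMap k P s * z = residueMap k P a) :
    localizationToResidueField (k := k) h (IsLocalization.mk' _ a s) = z :=
  (IsLocalization.lift_mk'_spec _ _ _ _).2 hz.symm

theorem mem_of_isAlgebraic {M : Ideal A} [M.IsPrime] (h : P ≤ M) {f u : A} (hf : f ∈ M)
    (hu : u ∉ M) (halg : IsAlgebraic k (residueMap k P f / residueMap k P u)) : f ∈ P := by
  have hu0 : residueMap k P u ≠ 0 := fun hu0 => hu (h (residueMap_eq_zero.1 hu0))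
  let ψ := localizationToResidueField (k := k) h
  let w := IsLocalization.mk' (Localization.AtPrime M) f (⟨u, hu⟩ : M.primeCompl)
  have hψw : ψ w = residueMap k P f / residueMap k P u :=
    localizationToResidueField_mk' h (mul_div_cancel₀ _ hu0)
  have hw : w ∈ IsLocalRing.maximalIdeal (Localization.AtPrime M) :=
    (IsLocalization.AtPrime.mk'_mem_maximal_iff _ M f ⟨u, hu⟩).2 hf
  have hinv : (ψ w)⁻¹ ∈ ψ.range :=
    Subalgebra.inv_mem_of_algebraic (A := ψ.range) (x := ⟨ψ w, w, rfl⟩) (by rwa [← hψw] at halg)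
  have hzero := map_eq_zero_of_inv_mem_range ψ hw hinv
  rw [hψw, div_eq_zero_iff, or_iff_left hu0] at hzero
  exact residueMap_eq_zero.1 hzero

end ResidueField

section PoissonResidueField

variable {k A : Type*} [Field k] [CommRing A] [Algebra k A] [PoissonAlgebra k A]

theorem inv_mem_center {L : Type*} [Field L] [Algebra k L] [PoissonAlgebra k L] {z : L}
    (hz : z ∈ center k L) : z⁻¹ ∈ center k L := by
  intro w
  have hwz : ham k w z = 0 := by rw [ham_apply, pb_skew, hz w, neg_zero]
  rw [pb_skew, ← ham_apply, Derivation.leibniz_inv, hwz, smul_zero, neg_zero]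

variable {P : Ideal A} [P.IsPrime]

/-- The Poisson structure on the residue field of a Poisson prime. -/
@[reducible] noncomputable def residueFieldPoisson (hP : IsPoissonIdeal k P) :
    PoissonAlgebra k (FractionRing (A ⧸ P)) :=
  letI := quotient hP
  fractionRing k (A ⧸ P)

theorem residueMap_pb (hP : IsPoissonIdeal k P) (a b : A) :
    letI := residueFieldPoisson hP
    residueMap k P (pb k a b) = pb k (residueMap k P a) (residueMap k P b) :=
  letI := quotient hP
  (fractionRing_pb_algebraMap (k := k) (Ideal.Quotient.mk P a)
    (Ideal.Quotient.mk P b)).symm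

/-- The numerator of the bracket of `b` with the fraction `f / u`. -/
def wronskian (k : Type*) {A : Type*} [Field k] [CommRing A] [Algebra k A] [PoissonAlgebra k A]
    (b u f : A) : A :=
  u * pb k b f - f * pb k b u

theorem wronskian_self (b u : A) : wronskian k b u u = 0 :=
  sub_self _

theorem wronskian_add_left (b b' u f : A) :
    wronskian k (b + b') u f = wronskian k b u f + wronskian k b' u f := by
  simp only [wronskian, pb_add_left]
  ring

theorem wronskian_sum {ι : Type*} (b u : A) (s : Finset ι) (c : ι → A) :
    wronskian k b u (∑ i ∈ s, c i) = ∑ i ∈ s, wronskian k b u (c i) := by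
  simp only [wronskian, ← ham_apply, map_sum, Finset.mul_sum, Finset.sum_mul,
    Finset.sum_sub_distrib]

theorem wronskian_mem {I : Ideal A} (hI : IsPoissonIdeal k I) (b u : A) {f : A} (hf : f ∈ I) :
    wronskian k b u f ∈ I :=
  sub_mem (I.mul_mem_left _ (hI b f hf)) (I.mul_mem_right _ hf)

theorem div_mem_fractCenter (hP : IsPoissonIdeal k P) {f u : A}
    (h : ∀ b, wronskian k b u f ∈ P) :
    residueMap k P f / residueMap k P u ∈ fractCenter k P hP := by
  let _ := residueFieldPoisson hP
  set z := residueMap k P f / residueMap k P u with hz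
  have hham : ham k z = 0 := residueField_derivation_ext fun b => by
    have hb := residueMap_eq_zero (k := k).2 (h b)
    rw [wronskian, map_sub, map_mul, map_mul, residueMap_pb hP, residueMap_pb hP] at hb
    rw [ham_apply, pb_skew, ← ham_apply, hz, Derivation.leibniz_div, ham_apply, ham_apply]
    simp only [smul_eq_mul, hb, mul_zero, neg_zero, Derivation.zero_apply]
  exact fun w => DFunLike.congr_fun hham w

/-- The ideal of denominators of an element of the residue field. -/
def denominatorIdeal (k : Type*) {A : Type*} [Field k] [CommRing A] [Algebra k A] {P : Ideal A}
    [P.IsPrime] (z : FractionRing (A ⧸ P)) : Ideal A where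
  carrier := {s | ∃ a, residueMap k P s * z = residueMap k P a}
  add_mem' := by
    rintro s s' ⟨a, ha⟩ ⟨a', ha'⟩
    exact ⟨a + a', by rw [map_add, map_add, add_mul, ha, ha']⟩
  zero_mem' := ⟨0, by rw [map_zero, zero_mul]⟩
  smul_mem' := by
    rintro c s ⟨a, ha⟩
    exact ⟨c * a, by rw [smul_eq_mul, map_mul, map_mul, mul_assoc, ha]⟩

theorem isPoissonIdeal_denominatorIdeal (hP : IsPoissonIdeal k P) {z : FractionRing (A ⧸ P)}
    (hz : z ∈ fractCenter k P hP) : IsPoissonIdeal k (denominatorIdeal k z) := by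
  let _ := residueFieldPoisson hP
  rintro c s ⟨a, ha⟩
  have hcz : pb k (residueMap k P c) z = 0 := by rw [pb_skew, hz, neg_zero]
  exact ⟨pb k c a, by rw [residueMap_pb hP, residueMap_pb hP, ← ha, pb_mul_right, hcz, mul_zero,
    add_zero]⟩

/- Central elements of the residue field of the Poisson core of `M` have denominators outside `M`,
so the centre, being a field, embeds into `A / M`. -/
theorem IsPoissonPrimitive.isPoissonRational [CharZero k] [Algebra.FiniteType k A] {P : Ideal A}
    (hP : IsPoissonPrimitive k P) : IsPoissonRational k P := by
  obtain ⟨M, hM, rfl⟩ := hP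
  obtain ⟨hprime, hpoisson⟩ := core_isPoissonPrime (k := k) hM.isPrime
  have := hM.isPrime
  have : Algebra.FiniteType k M.ResidueField := .of_surjective
    (IsScalarTower.toAlgHom k A M.ResidueField) M.algebraMap_residueField_surjective
  have : Module.Finite k M.ResidueField := finite_of_finite_type_of_isJacobsonRing k _
  let _ := residueFieldPoisson hpoisson
  refine ⟨hprime, hpoisson, isAlgebraic_of_le_range (localizationToResidueField (core_le M))
    (fun _ => inv_mem_center) fun z hz => ?_⟩
  obtain ⟨s, ⟨a, hsa⟩, hsM⟩ : ∃ s ∈ denominatorIdeal k z, s ∉ M := by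
    by_contra! hle
    obtain ⟨s, hs, hsz⟩ := exists_residueMap_mul_eq (k := k) z
    exact hs (le_core (isPoissonIdeal_denominatorIdeal hpoisson hz) hle hsz)
  exact ⟨_, localizationToResidueField_mk' (core_le M) (s := ⟨s, hsM⟩) hsa⟩

end PoissonResidueField

end PoissonAlgebra

namespace TorusAction

open PoissonAlgebra

section RationalToLocallyClosed

variable {k A : Type*} [Field k] [CommRing A] [Algebra k A] [PoissonAlgebra k A] {r : ℕ}
  {ρ : (Fin r → kˣ) →* (A ≃ₐ[k] A)}

theorem wronskian_mem_weightSpace (hpois : IsPoisson ρ) {l m n : Fin r → ℤ} {b u f : A}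
    (hb : b ∈ weightSpace ρ l) (hu : u ∈ weightSpace ρ m) (hf : f ∈ weightSpace ρ n) :
    wronskian k b u f ∈ weightSpace ρ (m + (l + n)) := by
  have hfu := weightSpace_mul_mem ρ hf (pb_mem_weightSpace hpois hb hu)
  rw [show n + (l + m) = m + (l + n) by abel] at hfu
  exact sub_mem (weightSpace_mul_mem ρ hu (pb_mem_weightSpace hpois hb hf)) hfu

/- Let `u` be a summand of `f = ∑ i ∈ s, c i` with `u ∉ Q`. The Wronskian of `u` and `f` is a
shorter sum, so by induction `f / u` is central modulo `P`, hence algebraic; as `f / u` vanishes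
modulo `Q`, it is zero. -/
theorem sum_mem_of_isPoissonRational (hrat : IsRational ρ) (hpois : IsPoisson ρ) {P Q : Ideal A}
    (hP : IsPoissonRational k P) (hQ : IsPoissonPrime k Q) (hle : P ≤ Q)
    (hPQ : ∀ m, ∀ a ∈ weightSpace ρ m, a ∈ Q → a ∈ P) {ι : Type*} (s : Finset ι) (c : ι → A)
    (hc : ∀ i ∈ s, ∃ m, c i ∈ weightSpace ρ m) (hs : ∑ i ∈ s, c i ∈ Q) : ∑ i ∈ s, c i ∈ P := by
  classical
  obtain ⟨hPprime, hPpois, hPalg⟩ := hP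
  have := hQ.1
  induction s using Finset.strongInduction generalizing c with
  | H s ih =>
    obtain rfl | ⟨i, hi⟩ := s.eq_empty_or_nonempty
    · simp
    obtain ⟨m, hm⟩ := hc i hi
    have hsum := Finset.add_sum_erase s c hi
    have herase := Finset.erase_ssubset hi
    by_cases hu : c i ∈ Q
    · rw [← hsum] at hs ⊢
      exact add_mem (hPQ m _ hm hu) (ih _ herase c (fun j hj => hc j (Finset.mem_of_mem_erase hj))
        ((Ideal.add_mem_iff_right _ hu).1 hs))
    have hwronskian (b : A) : wronskian k b (c i) (∑ j ∈ s, c j) ∈ P := by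
      induction b using weight_induction hrat with
      | add b b' hb hb' => exact wronskian_add_left (k := k) b b' _ _ ▸ add_mem hb hb'
      | weight l b hb =>
        have hmem := wronskian_mem (k := k) hQ.2 b (c i) hs
        rw [wronskian_sum, ← Finset.add_sum_erase s _ hi, wronskian_self, zero_add] at hmem ⊢
        refine ih _ herase _ (fun j hj => ?_) hmem
        obtain ⟨n, hn⟩ := hc j (Finset.mem_of_mem_erase hj)
        exact ⟨_, wronskian_mem_weightSpace hpois hb hm hn⟩
    exact mem_of_isAlgebraic hle hs hu (hPalg _ (div_mem_fractCenter hPpois hwronskian))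

theorem le_of_weightCore_le (hrat : IsRational ρ) (hpois : IsPoisson ρ) {P Q : Ideal A}
    (hP : IsPoissonRational k P) (hQ : IsPoissonPrime k Q) (hle : P ≤ Q)
    (hcore : weightCore ρ Q ≤ P) : Q ≤ P := by
  intro a ha
  obtain ⟨s, c, hc, rfl⟩ := exists_sum_eq hrat a
  exact sum_mem_of_isPoissonRational hrat hpois hP hQ hle
    (fun _ _ hb hbQ => hcore (mem_weightCore hb hbQ)) s c (fun m _ => ⟨m, hc m⟩) ha

theorem isLocallyClosedPoint_of_isPoissonRational [CharZero k] (hrat : IsRational ρ)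
    (hpois : IsPoisson ρ)
    (hfin : {P : Ideal A | IsPoissonPrime k P ∧ IsStable ρ P}.Finite) {P : Ideal A}
    (hP : IsPoissonRational k P) : IsLocallyClosedPoint k P := by
  classical
  have hprime : P.IsPrime := hP.1
  let S := {J ∈ hfin.toFinset | ¬ J ≤ P}
  have hinf : ¬ S.inf id ≤ P := fun h => by
    obtain ⟨J, hJ, hJP⟩ := hprime.inf_le'.1 h
    exact (Finset.mem_filter.1 hJ).2 hJP
  obtain ⟨f, hf, hfP⟩ := Set.not_subset.1 hinf
  refine isLocallyClosedPoint_iff.2 ⟨⟨hprime, hP.2.1⟩, f, hfP, fun Q hQ hPQ hfQ => ?_⟩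
  refine le_antisymm (le_of_weightCore_le hrat hpois hP hQ hPQ ?_) hPQ
  by_contra hcore
  have hstable : IsPoissonPrime k (weightCore ρ Q) ∧ IsStable ρ (weightCore ρ Q) :=
    ⟨⟨weightCore_isPrime hrat hQ.1, weightCore_isPoissonIdeal hrat hpois hQ.2⟩,
      isStable_weightCore Q⟩
  have hmem : weightCore ρ Q ∈ S := Finset.mem_filter.2 ⟨hfin.mem_toFinset.2 hstable, hcore⟩
  exact hfQ (weightCore_le Q (Finset.inf_le (f := id) hmem hf))

theorem dixmierMoeglin_of_finite [CharZero k] [Algebra.FiniteType k A] (hrat : IsRational ρ)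
    (hpois : IsPoisson ρ)
    (hfin : {P : Ideal A | IsPoissonPrime k P ∧ IsStable ρ P}.Finite) : DixmierMoeglin k A := by
  have hclosed (P : Ideal A) : IsPoissonRational k P → IsLocallyClosedPoint k P :=
    isLocallyClosedPoint_of_isPoissonRational hrat hpois hfin
  have hprimitive (P : Ideal A) : IsLocallyClosedPoint k P → IsPoissonPrimitive k P :=
    IsLocallyClosedPoint.isPoissonPrimitive
  have hrational (P : Ideal A) : IsPoissonPrimitive k P → IsPoissonRational k P :=
    IsPoissonPrimitive.isPoissonRational
  exact ⟨Set.Subset.antisymm (fun P hP => hclosed P (hrational P hP)) hprimitive,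
    Set.Subset.antisymm (fun P hP => hrational P (hprimitive P hP)) hclosed⟩

end RationalToLocallyClosed

end TorusAction

section ConjugateMean

open Polynomial Differential

/-- The mean of the conjugates of `x` over `K`, read off from the minimal polynomial of `x`. -/
noncomputable def conjugateMean (K : Type*) {L : Type*} [Field K] [Field L] [Algebra K L] (x : L) :
    K :=
  -(minpoly K x).nextCoeff / (minpoly K x).natDegree

theorem coeff_implicitDeriv_linear {K : Type*} [CommRing K] [Differential K] (α β : K) (f : K[X])
    (n : ℕ) : (implicitDeriv (C α * X + C β) f).coeff n =
      (f.coeff n)′ + n * α * f.coeff n + (n + 1) * β * f.coeff (n + 1) := by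
  rw [implicitDeriv, Derivation.add_apply, coeff_add, coeff_mapCoeffs, Derivation.smul_apply,
    Derivation.restrictScalars_apply, derivative'_apply, smul_eq_mul, add_mul, mul_assoc,
    coeff_add, coeff_C_mul, coeff_C_mul, coeff_derivative]
  cases n with
  | zero => simp
  | succ n => rw [coeff_X_mul, coeff_derivative]; push_cast; ring

variable {K L : Type*} [Field K] [Field L] [Algebra K L] [Differential K] [Differential L]
  [DifferentialAlgebra K L]

/- The polynomial `f′ - d α f`, where `f` is the minimal polynomial of `x`, `d` its degree, and `f′`
the derivative of `f(x)` as a polynomial in `x`, vanishes at `x` and has degree less than `d`. -/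
theorem implicitDeriv_minpoly {x : L} (hx : IsIntegral K x) {α β : K}
    (h : x′ = algebraMap K L α * x + algebraMap K L β) :
    implicitDeriv (C α * X + C β) (minpoly K x) =
      C ((minpoly K x).natDegree * α) * minpoly K x := by
  set f := minpoly K x
  have hmonic : f.Monic := minpoly.monic hx
  have hroot : aeval x (implicitDeriv (C α * X + C β) f - C (f.natDegree * α) * f) = 0 := by
    rw [map_sub, ← deriv_aeval_eq_implicitDeriv x _ (by simpa using h), map_mul, minpoly.aeval,
      map_zero, mul_zero, sub_zero]
  have hdegree : (implicitDeriv (C α * X + C β) f - C (f.natDegree * α) * f).degree < f.degree := by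
    rw [degree_eq_natDegree hmonic.ne_zero, degree_lt_iff_coeff_zero]
    intro m hm
    have hsucc : f.coeff (m + 1) = 0 := coeff_eq_zero_of_natDegree_lt (by omega)
    rw [coeff_sub, coeff_C_mul, coeff_implicitDeriv_linear, hsucc]
    rcases hm.eq_or_lt with rfl | hlt
    · rw [hmonic.coeff_natDegree]
      simp
    · rw [coeff_eq_zero_of_natDegree_lt hlt]
      simp
  by_contra hne
  exact (minpoly.degree_le_of_ne_zero K x (sub_ne_zero.2 hne) hroot).not_gt hdegree

theorem deriv_nextCoeff_minpoly {x : L} (hx : IsIntegral K x) {α β : K}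
    (h : x′ = algebraMap K L α * x + algebraMap K L β) :
    (minpoly K x).nextCoeff′ = α * (minpoly K x).nextCoeff - (minpoly K x).natDegree * β := by
  have hlead : (minpoly K x).leadingCoeff = 1 := minpoly.monic hx
  have hpos := minpoly.natDegree_pos hx
  obtain ⟨e, he⟩ := Nat.exists_eq_succ_of_ne_zero hpos.ne'
  have hcoeff := congrArg (coeff · e) (implicitDeriv_minpoly hx h)
  rw [leadingCoeff, he] at hlead
  simp only [coeff_implicitDeriv_linear, coeff_C_mul, hlead, he] at hcoeff
  rw [nextCoeff_of_natDegree_pos hpos, he, Nat.succ_sub_one]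
  push_cast at hcoeff ⊢
  linear_combination hcoeff

theorem deriv_conjugateMean [CharZero K] {x : L} (hx : IsIntegral K x) {α β : K}
    (h : x′ = algebraMap K L α * x + algebraMap K L β) :
    (conjugateMean K x)′ = α * conjugateMean K x + β := by
  have hd0 : ((minpoly K x).natDegree : K) ≠ 0 :=
    Nat.cast_ne_zero.2 (minpoly.natDegree_pos hx).ne'
  rw [conjugateMean, Derivation.leibniz_div, Derivation.map_natCast, map_neg,
    deriv_nextCoeff_minpoly hx h, smul_zero, sub_zero, smul_eq_mul, smul_eq_mul]
  field_simp
  ring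

end ConjugateMean

section FieldDerivation

variable {k L : Type*} [Field k] [Field L] [Algebra k L] {K : IntermediateField k L}

theorem derivation_conjugateMean [CharZero k] (E : Derivation k L L) (hE : ∀ a ∈ K, E a ∈ K)
    {x α β : L} (hx : IsIntegral K x) (hα : α ∈ K) (hβ : β ∈ K) (h : E x = α * x + β) :
    E (conjugateMean K x) = α * conjugateMean K x + β := by
  have : CharZero K := charZero_of_injective_algebraMap (algebraMap k K).injective
  let _ : Differential L := ⟨E.restrictScalars ℤ⟩
  let EK : K →+ K := (E.toLinearMap.toAddMonoidHom.comp K.subtype).codRestrict K (fun a => hE a a.2)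
  let _ : Differential K := ⟨.mk' EK.toIntLinearMap fun a b => Subtype.ext (E.leibniz a b)⟩
  have : DifferentialAlgebra K L := ⟨fun _ => rfl⟩
  exact congrArg Subtype.val (deriv_conjugateMean hx (α := ⟨α, hα⟩) (β := ⟨β, hβ⟩) h)

theorem derivation_eq_zero_of_isIntegral [CharZero k] {E : Derivation k L L}
    (hE : ∀ a ∈ K, E a = 0) {w : L} (hw : IsIntegral K w) : E w = 0 := by
  have : CharZero K := charZero_of_injective_algebraMap (algebraMap k K).injective
  let EK : Derivation K L L := .mk'
    { E with map_smul' := fun a y => by simp [Algebra.smul_def, hE] } E.leibniz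
  have hroot := EK.map_aeval (minpoly K w) w
  rw [minpoly.aeval, map_zero, eq_comm, smul_eq_zero] at hroot
  exact hroot.resolve_left ((minpoly.irreducible hw).separable.aeval_derivative_ne_zero
    (minpoly.aeval K w))

end FieldDerivation

namespace PoissonAlgebra

section OreVariable

variable {k A : Type*} [Field k] [CommRing A] [Algebra k A] [PoissonAlgebra k A]

/-- A Poisson subalgebra `R` stable under `D`, together with an element `x` whose brackets with `R`
are those of the variable of a Poisson–Ore extension `R[x]`: `{x, r} = D(r) x + δ(r)` with
`δ(r) ∈ R`. No algebraic independence of `x` over `R` is assumed, and `x` is an eigenvector of `D`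
of eigenvalue `c`. -/
structure IsOreVariable (R : Subalgebra k A) (D : Derivation k A A) (c : k) (x : A) : Prop where
  derivation_mem : ∀ r ∈ R, D r ∈ R
  pb_mem : ∀ r ∈ R, ∀ s ∈ R, pb k r s ∈ R
  derivation_self : D x = c • x
  pb_sub_mem : ∀ r ∈ R, pb k x r - D r * x ∈ R

end OreVariable

section Field

variable {k L : Type*} [Field k] [CharZero k] [Field L] [Algebra k L] [PoissonAlgebra k L]
  {K : IntermediateField k L} {D : Derivation k L L} {c : k}

/- The derivation `{w, -} - w D` vanishes on `K`, hence at `w`, where its value is `-c w ^ 2`. -/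
theorem eq_zero_of_pb_eq (hc : c ≠ 0) {w : L} (hw : IsIntegral K w) (hD : D w = c • w)
    (hpb : ∀ r ∈ K, pb k w r = D r * w) : w = 0 := by
  have hzero : (ham k w - w • D) w = 0 := derivation_eq_zero_of_isIntegral (K := K)
    (fun r hr => by
      rw [Derivation.sub_apply, ham_apply, Derivation.smul_apply, smul_eq_mul, hpb r hr, mul_comm,
        sub_self]) hw
  rw [Derivation.sub_apply, ham_apply, pb_self, Derivation.smul_apply, hD, zero_sub, neg_eq_zero,
    smul_comm, smul_eq_mul, smul_eq_zero, mul_self_eq_zero] at hzero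
  exact hzero.resolve_left hc

theorem IsOreVariable.eq_of_pb_sub_eq {x y : L} (hx : IsOreVariable K.toSubalgebra D c x)
    (hc : c ≠ 0) (hxK : IsIntegral K x) (hy : y ∈ K) (hD : D y = c • y)
    (hpb : ∀ r ∈ K, pb k y r - D r * y = pb k x r - D r * x) : x = y := by
  refine sub_eq_zero.1 (eq_zero_of_pb_eq (K := K) (D := D) hc
    (hxK.sub (isIntegral_algebraMap (x := (⟨y, hy⟩ : K)))) ?_ fun r hr => ?_)
  · rw [map_sub, hx.derivation_self, hD, smul_sub]
  · rw [pb_sub_left]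
    linear_combination -hpb r hr

/- The mean `y ∈ K` of the conjugates of `x` satisfies the same equations as `x`. -/
theorem IsOreVariable.mem_of_isIntegral {x : L} (hx : IsOreVariable K.toSubalgebra D c x)
    (hc : c ≠ 0) (hint : IsIntegral K x) : x ∈ K := by
  have hcK : algebraMap k L c ∈ K := K.algebraMap_mem c
  refine (hx.eq_of_pb_sub_eq hc hint (conjugateMean K x).2 ?_ fun r hr => ?_) ▸
    (conjugateMean K x).2
  · rw [derivation_conjugateMean D hx.derivation_mem hint hcK (zero_mem K)
      (by rw [hx.derivation_self, Algebra.smul_def, add_zero]), add_zero, Algebra.smul_def]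
  · have hmean := derivation_conjugateMean (-ham k r)
      (fun a ha => neg_mem (hx.pb_mem r hr a ha)) hint (hx.derivation_mem r hr)
      (hx.pb_sub_mem r hr) (by
        rw [Derivation.neg_apply, ham_apply, ← pb_skew]
        ring)
    rw [Derivation.neg_apply, ham_apply, ← pb_skew] at hmean
    rw [hmean, add_sub_cancel_left]

end Field

section ImageField

variable {k A L : Type*} [Field k] [CommRing A] [Algebra k A] [Field L] [Algebra k L]
  {R : Subalgebra k A} {φ : A →ₐ[k] L}

/-- The subfield of `L` generated by the image of `R`. -/
def imageField (R : Subalgebra k A) (φ : A →ₐ[k] L) : IntermediateField k L :=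
  IntermediateField.adjoin k (R.map φ)

theorem map_mem_imageField {r : A} (hr : r ∈ R) : φ r ∈ imageField R φ :=
  IntermediateField.subset_adjoin k _ ⟨r, hr, rfl⟩

theorem mem_imageField {z : L} :
    z ∈ imageField R φ ↔ ∃ t ∈ R, ∃ s ∈ R, φ s ≠ 0 ∧ φ s * z = φ t := by
  constructor
  · intro hz
    rw [imageField, IntermediateField.mem_adjoin_iff_div, Algebra.adjoin_eq] at hz
    obtain ⟨_, ⟨t, ht, rfl⟩, _, ⟨s, hs, rfl⟩, rfl⟩ := hz
    change ∃ t' ∈ R, ∃ s' ∈ R, φ s' ≠ 0 ∧ φ s' * (φ t / φ s) = φ t'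
    by_cases hs0 : φ s = 0
    · exact ⟨0, R.zero_mem, 1, R.one_mem, by simp, by simp [hs0]⟩
    · exact ⟨t, ht, s, hs, hs0, mul_div_cancel₀ _ hs0⟩
  · rintro ⟨t, ht, s, hs, hs0, hst⟩
    rw [eq_div_of_mul_eq hs0 ((mul_comm _ _).trans hst)]
    exact div_mem (map_mem_imageField ht) (map_mem_imageField hs)

theorem derivation_mem_imageField {E : Derivation k L L}
    (hE : ∀ r ∈ R, E (φ r) ∈ imageField R φ) {z : L} (hz : z ∈ imageField R φ) :
    E z ∈ imageField R φ := by
  induction hz using IntermediateField.adjoin_induction with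
  | mem z hz => obtain ⟨r, hr, rfl⟩ := hz; exact hE r hr
  | algebraMap a => rw [E.map_algebraMap]; exact zero_mem _
  | add z w _ _ hz hw => rw [map_add]; exact add_mem hz hw
  | inv z hz hEz =>
    rw [E.leibniz_inv]
    exact mul_mem (neg_mem (pow_mem (inv_mem hz) 2)) hEz
  | mul z w hz hw hEz hEw =>
    rw [E.leibniz]
    exact add_mem (mul_mem hz hEw) (mul_mem hw hEz)

theorem derivation_eqOn_imageField {E₁ E₂ : Derivation k L L} (hE : ∀ r ∈ R, E₁ (φ r) = E₂ (φ r))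
    {z : L} (hz : z ∈ imageField R φ) : E₁ z = E₂ z := by
  obtain ⟨t, ht, s, hs, hs0, hst⟩ := mem_imageField.1 hz
  rw [eq_div_of_mul_eq hs0 ((mul_comm _ _).trans hst), E₁.leibniz_div, E₂.leibniz_div, hE t ht,
    hE s hs]

theorem map_aeval (φ : A →ₐ[k] L) (p : Polynomial R) (x : A) :
    φ (Polynomial.aeval x p) = p.eval₂ ((φ : A →+* L).comp (algebraMap R A)) (φ x) :=
  Polynomial.hom_eval₂ p (algebraMap R A) (φ : A →+* L) x

theorem map_coeff_eq_zero {x : A} (hx : ¬ IsIntegral (imageField R φ) (φ x)) {p : Polynomial R}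
    (hp : φ (Polynomial.aeval x p) = 0) (i : ℕ) : φ (p.coeff i) = 0 := by
  let ψ : R →+* imageField R φ := ((φ : A →+* L).comp (algebraMap R A)).codRestrict _
    fun r => map_mem_imageField r.2
  have hroot : Polynomial.aeval (φ x) (p.map ψ) = 0 := by
    rw [Polynomial.aeval_def, Polynomial.eval₂_map, ← hp, map_aeval]
    rfl
  have hzero : p.map ψ = 0 := by
    by_contra hne
    exact hx (IsAlgebraic.isIntegral ⟨_, hne, hroot⟩)
  have hcoeff := congrArg (Polynomial.coeff · i) hzero
  simp only [Polynomial.coeff_map, Polynomial.coeff_zero] at hcoeff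
  exact congrArg Subtype.val hcoeff

theorem map_eval_scaleRoots {x : A} {s t : R} (hst : φ s * φ x = φ t) (p : Polynomial R) :
    φ ((p.scaleRoots s).eval t : R) = φ s ^ p.natDegree * φ (Polynomial.aeval x p) := by
  have heval : φ ((p.scaleRoots s).eval t : R) =
      (p.scaleRoots s).eval₂ ((φ : A →+* L).comp (algebraMap R A)) (φ t) :=
    Polynomial.hom_eval₂ _ (RingHom.id R) ((φ : A →+* L).comp (algebraMap R A)) t
  rw [heval, map_aeval, ← hst]
  exact Polynomial.scaleRoots_eval₂_mul ((φ : A →+* L).comp (algebraMap R A)) (φ x) s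

end ImageField

section Transfer

variable {k A L L' : Type*} [Field k] [CommRing A] [Algebra k A] [PoissonAlgebra k A]
  [Field L] [Algebra k L] [PoissonAlgebra k L] [Field L'] [Algebra k L'] [PoissonAlgebra k L']
  {R : Subalgebra k A} {D : Derivation k A A} {c : k} {x : A}

/-- A homomorphism of Poisson algebras which intertwines two derivations. -/
structure IsDifferentialPoissonHom (φ : A →ₐ[k] L) (D : Derivation k A A) (E : Derivation k L L) :
    Prop where
  map_pb : ∀ a b, φ (pb k a b) = pb k (φ a) (φ b)
  map_derivation : ∀ a, φ (D a) = E (φ a)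

variable {φ : A →ₐ[k] L} {E : Derivation k L L} {φ' : A →ₐ[k] L'} {E' : Derivation k L' L'}

theorem IsOreVariable.map (hx : IsOreVariable R D c x) (hφ : IsDifferentialPoissonHom φ D E) :
    IsOreVariable (imageField R φ).toSubalgebra E c (φ x) where
  derivation_mem _ := derivation_mem_imageField fun r hr =>
    hφ.map_derivation r ▸ map_mem_imageField (hx.derivation_mem r hr)
  pb_mem z hz w hw := by
    have hham (r : A) (hr : r ∈ R) : ham k (φ r) z ∈ imageField R φ :=
      derivation_mem_imageField (fun s hs => by
        rw [ham_apply, ← hφ.map_pb]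
        exact map_mem_imageField (hx.pb_mem r hr s hs)) hz
    exact derivation_mem_imageField (E := ham k z) (fun r hr => by
      rw [ham_apply, pb_skew]
      exact neg_mem (hham r hr)) hw
  derivation_self := by rw [← hφ.map_derivation, hx.derivation_self, map_smul]
  pb_sub_mem z hz := by
    have hmem := derivation_mem_imageField (E := ham k (φ x) - φ x • E) (fun r hr => by
      have hr' := map_mem_imageField (φ := φ) (hx.pb_sub_mem r hr)
      rwa [map_sub, map_mul, hφ.map_pb, hφ.map_derivation, mul_comm] at hr') hz
    rwa [Derivation.sub_apply, Derivation.smul_apply, smul_eq_mul, mul_comm] at hmem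

/- Clearing denominators in `E (φ t / φ s) = c (φ t / φ s)`. -/
theorem derivation_div_eq_iff (hφ : IsDifferentialPoissonHom φ D E) {s : A} (hs : φ s ≠ 0) (t : A) :
    E (φ t / φ s) = c • (φ t / φ s) ↔ φ (s * D t - t * D s - c • (s * t)) = 0 := by
  rw [Derivation.leibniz_div]
  simp only [smul_eq_mul, Algebra.smul_def, map_sub, map_mul, hφ.map_derivation, AlgHom.commutes]
  rw [← sub_eq_zero (a := _ * _)]
  field_simp
  rw [mul_zero]

theorem pb_div_sub_eq_iff (hφ : IsDifferentialPoissonHom φ D E) {s : A} (hs : φ s ≠ 0)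
    (t r q : A) : pb k (φ t / φ s) (φ r) - E (φ r) * (φ t / φ s) = φ q ↔
      φ (s * pb k t r - t * pb k s r - D r * (s * t) - s * s * q) = 0 := by
  rw [pb_skew, ← ham_apply, Derivation.leibniz_div, ham_apply, ham_apply, pb_skew k (φ r),
    pb_skew k (φ r)]
  simp only [smul_eq_mul, map_sub, map_mul, hφ.map_derivation, hφ.map_pb]
  rw [← sub_eq_zero (a := _ - _)]
  field_simp
  ring_nf

variable [CharZero k]

theorem IsOreVariable.mul_map_eq_map (hx : IsOreVariable R D c x) (hc : c ≠ 0)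
    (hφ : IsDifferentialPoissonHom φ D E) (hφ' : IsDifferentialPoissonHom φ' D E')
    (hR : ∀ r ∈ R, φ r = 0 → φ' r = 0) (hxφ' : φ' x ∈ imageField R φ') {s t : A} (hs : s ∈ R)
    (ht : t ∈ R) (hs0 : φ s ≠ 0) (hs0' : φ' s ≠ 0) (hst : φ s * φ x = φ t) :
    φ' s * φ' x = φ' t := by
  have hdiv : φ x = φ t / φ s := eq_div_of_mul_eq hs0 ((mul_comm _ _).trans hst)
  suffices φ' x = φ' t / φ' s by rw [this, mul_div_cancel₀ _ hs0']
  refine (hx.map hφ').eq_of_pb_sub_eq hc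
    (isIntegral_algebraMap (x := (⟨_, hxφ'⟩ : imageField R φ')))
    (div_mem (map_mem_imageField ht) (map_mem_imageField hs)) ?_ fun z hz => ?_
  · refine (derivation_div_eq_iff hφ' hs0' t).2 (hR _ ?_ ((derivation_div_eq_iff hφ hs0 t).1 ?_))
    · exact sub_mem (sub_mem (mul_mem hs (hx.derivation_mem t ht))
        (mul_mem ht (hx.derivation_mem s hs))) (R.smul_mem (mul_mem hs ht) c)
    · rw [← hdiv, ← hφ.map_derivation, hx.derivation_self, map_smul]
  · have hgen (r : A) (hr : r ∈ R) : (ham k (φ' t / φ' s) - (φ' t / φ' s) • E') (φ' r) =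
        (ham k (φ' x) - φ' x • E') (φ' r) := by
      have hq : φ (pb k x r - D r * x) = pb k (φ x) (φ r) - E (φ r) * φ x := by
        rw [map_sub, map_mul, hφ.map_pb, hφ.map_derivation]
      have hpb := (pb_div_sub_eq_iff hφ' hs0' t r (pb k x r - D r * x)).2 (hR _ ?_
        ((pb_div_sub_eq_iff hφ hs0 t r _).1 (by rw [← hdiv, hq])))
      · rw [map_sub, map_mul, hφ'.map_pb, hφ'.map_derivation] at hpb
        simpa only [Derivation.sub_apply, Derivation.smul_apply, ham_apply, smul_eq_mul,
          mul_comm] using hpb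
      · exact sub_mem (sub_mem (sub_mem (mul_mem hs (hx.pb_mem t ht r hr))
          (mul_mem ht (hx.pb_mem s hs r hr))) (mul_mem (hx.derivation_mem r hr) (mul_mem hs ht)))
          (mul_mem (mul_mem hs hs) (hx.pb_sub_mem r hr))
    have heq := derivation_eqOn_imageField hgen hz
    simpa only [Derivation.sub_apply, Derivation.smul_apply, ham_apply, smul_eq_mul,
      mul_comm] using heq

theorem IsOreVariable.map_aeval_eq_zero (hx : IsOreVariable R D c x) (hc : c ≠ 0)
    (hφ : IsDifferentialPoissonHom φ D E) (hφ' : IsDifferentialPoissonHom φ' D E')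
    (hR : ∀ r ∈ R, φ r = 0 ↔ φ' r = 0)
    (hmem : φ x ∈ imageField R φ ↔ φ' x ∈ imageField R φ') {p : Polynomial R}
    (hp : φ (Polynomial.aeval x p) = 0) : φ' (Polynomial.aeval x p) = 0 := by
  by_cases hxφ : φ x ∈ imageField R φ
  · obtain ⟨t, ht, s, hs, hs0, hst⟩ := mem_imageField.1 hxφ
    have hs0' : φ' s ≠ 0 := fun h => hs0 ((hR s hs).2 h)
    have hst' := hx.mul_map_eq_map hc hφ hφ' (fun r hr => (hR r hr).1) (hmem.1 hxφ) hs ht hs0 hs0'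
      hst
    have heval := map_eval_scaleRoots (s := ⟨s, hs⟩) (t := ⟨t, ht⟩) hst p
    rw [hp, mul_zero, hR _ (Subtype.property _), map_eval_scaleRoots (x := x) hst'] at heval
    exact (mul_eq_zero.1 heval).resolve_left (pow_ne_zero _ hs0')
  · have hcoeff := map_coeff_eq_zero (fun hint => hxφ ((hx.map hφ).mem_of_isIntegral hc hint)) hp
    rw [Polynomial.aeval_eq_sum_range, map_sum]
    refine Finset.sum_eq_zero fun i _ => ?_
    rw [Subalgebra.smul_def, smul_eq_mul, map_mul, (hR _ (p.coeff i).2).1 (hcoeff i), zero_mul]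

end Transfer

section Generators

variable {k A : Type*} [Field k] [CommRing A] [Algebra k A]

theorem derivation_mem_adjoin (D : Derivation k A A) {s : Set A}
    (hD : ∀ a ∈ s, D a ∈ Algebra.adjoin k s) {a : A} (ha : a ∈ Algebra.adjoin k s) :
    D a ∈ Algebra.adjoin k s := by
  induction ha using Algebra.adjoin_induction with
  | mem a ha => exact hD a ha
  | algebraMap c => rw [D.map_algebraMap]; exact zero_mem _
  | add a b _ _ ha hb => rw [map_add]; exact add_mem ha hb
  | mul a b ha hb hDa hDb =>
    rw [D.leibniz, smul_eq_mul, smul_eq_mul]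
    exact add_mem (mul_mem ha hDb) (mul_mem hb hDa)

section InitialAdjoin

variable {n : ℕ} {x : Fin n → A} {j : ℕ}

variable (k) in
/-- The subalgebra generated by the first `j` of the elements `x 0, …, x (n - 1)`, the
`k⟨x₁, …, x_j⟩` of the theorem. -/
def initialAdjoin (x : Fin n → A) (j : ℕ) : Subalgebra k A :=
  Algebra.adjoin k (x '' {l | l.val < j})

theorem mem_initialAdjoin {l : Fin n} (hl : l.val < j) : x l ∈ initialAdjoin k x j :=
  Algebra.subset_adjoin (Set.mem_image_of_mem x hl)

theorem initialAdjoin_mono (x : Fin n → A) : Monotone (initialAdjoin k x) := fun _ _ hij =>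
  Algebra.adjoin_mono (Set.image_mono fun _ hl => lt_of_lt_of_le hl hij)

theorem initialAdjoin_zero (x : Fin n → A) : initialAdjoin k x 0 = ⊥ := by
  simp [initialAdjoin]

theorem initialAdjoin_self (x : Fin n → A) :
    initialAdjoin k x n = Algebra.adjoin k (Set.range x) := by
  simp [initialAdjoin]

theorem derivation_mem_initialAdjoin (D : Derivation k A A)
    (hD : ∀ l : Fin n, l.val < j → D (x l) ∈ initialAdjoin k x j) {a : A}
    (ha : a ∈ initialAdjoin k x j) : D a ∈ initialAdjoin k x j := by
  refine derivation_mem_adjoin D ?_ ha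
  rintro _ ⟨l, hl, rfl⟩
  exact hD l hl

theorem exists_aeval_eq_of_mem_initialAdjoin (i : Fin n) {a : A}
    (ha : a ∈ initialAdjoin k x (i + 1)) :
    ∃ p : Polynomial (initialAdjoin k x i), Polynomial.aeval (x i) p = a := by
  have hle : initialAdjoin k x (i + 1) ≤ (Polynomial.aeval (x i) :
      Polynomial (initialAdjoin k x i) →ₐ[_] A).range.restrictScalars k := by
    refine Algebra.adjoin_le ?_
    rintro _ ⟨l, hl, rfl⟩
    rcases (Nat.lt_succ_iff.1 hl).lt_or_eq with hlt | heq
    · exact ⟨Polynomial.C ⟨x l, mem_initialAdjoin hlt⟩, Polynomial.aeval_C _ _⟩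
    · obtain rfl := Fin.ext heq
      exact ⟨Polynomial.X, Polynomial.aeval_X _⟩
  exact hle ha

variable [PoissonAlgebra k A]

theorem pb_mem_initialAdjoin
    (h : ∀ i l : Fin n, l < i → i.val < j → pb k (x i) (x l) ∈ initialAdjoin k x j) {a b : A}
    (ha : a ∈ initialAdjoin k x j) (hb : b ∈ initialAdjoin k x j) :
    pb k a b ∈ initialAdjoin k x j := by
  have hgen (i : Fin n) (hi : i.val < j) {b : A} (hb : b ∈ initialAdjoin k x j) :
      pb k (x i) b ∈ initialAdjoin k x j := by
    refine derivation_mem_initialAdjoin (ham k (x i)) (fun l hl => ?_) hb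
    rw [ham_apply]
    rcases lt_trichotomy l i with hli | rfl | hil
    · exact h i l hli hi
    · exact pb_self k (x l) ▸ zero_mem _
    · exact pb_skew k (x i) (x l) ▸ neg_mem (h l i hil hl)
  refine derivation_mem_initialAdjoin (ham k a) (fun l hl => ?_) hb
  rw [ham_apply, pb_skew]
  exact neg_mem (hgen l hl ha)

theorem isOreVariable_initialAdjoin {D : Fin n → Derivation k A A} {c : Fin n → Fin n → k}
    (hD : ∀ i l, D i (x l) = c i l • x l)
    (h : ∀ i l : Fin n, l < i → pb k (x i) (x l) - D i (x l) * x i ∈ initialAdjoin k x i)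
    (i : Fin n) : IsOreVariable (initialAdjoin k x i) (D i) (c i i) (x i) where
  derivation_mem _ := derivation_mem_initialAdjoin (D i) fun l hl =>
    hD i l ▸ Subalgebra.smul_mem _ (mem_initialAdjoin hl) _
  pb_mem _ hr _ hs := by
    refine pb_mem_initialAdjoin (fun m l hl hm => ?_) hr hs
    have hmem := initialAdjoin_mono x hm.le (h m l hl)
    rw [hD] at hmem
    have hprod : c m l • x l * x m ∈ initialAdjoin k x i :=
      mul_mem (Subalgebra.smul_mem _ (mem_initialAdjoin ((Fin.lt_def.1 hl).trans hm)) _)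
        (mem_initialAdjoin hm)
    exact sub_add_cancel (pb k (x m) (x l)) _ ▸ add_mem hmem hprod
  derivation_self := hD i i
  pb_sub_mem r hr := by
    have hmem := derivation_mem_initialAdjoin (ham k (x i) - x i • D i) (fun l hl => by
      simpa only [Derivation.sub_apply, ham_apply, Derivation.smul_apply, smul_eq_mul, mul_comm]
        using h i l hl) hr
    simpa only [Derivation.sub_apply, ham_apply, Derivation.smul_apply, smul_eq_mul, mul_comm]
      using hmem

end InitialAdjoin

section FractionModulo

variable {R : Subalgebra k A} {x : A}

/-- The residue class of `x` modulo the prime ideal `P` lies in the fraction field of the image of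
`R`. -/
def IsFractionModulo (R : Subalgebra k A) (x : A) (P : Ideal A) : Prop :=
  ∃ _ : P.IsPrime, residueMap k P x ∈ imageField R (residueMap k P)

variable [PoissonAlgebra k A]

theorem isDifferentialPoissonHom_residueMap {P : Ideal A} [P.IsPrime] (hP : IsPoissonIdeal k P)
    (D : Derivation k A A) (hD : ∀ a ∈ P, D a ∈ P) :
    letI := residueFieldPoisson hP
    IsDifferentialPoissonHom (residueMap k P) D (residueDerivation D hD) :=
  letI := residueFieldPoisson hP
  ⟨residueMap_pb hP, fun a => (residueDerivation_residueMap D hD a).symm⟩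

theorem IsOreVariable.aeval_mem [CharZero k] {D : Derivation k A A} {c : k}
    (hx : IsOreVariable R D c x) (hc : c ≠ 0) {P Q : Ideal A} (hP : IsPoissonPrime k P)
    (hDP : ∀ a ∈ P, D a ∈ P) (hQ : IsPoissonPrime k Q) (hDQ : ∀ a ∈ Q, D a ∈ Q)
    (hR : ∀ r ∈ R, r ∈ P ↔ r ∈ Q)
    (hfrac : IsFractionModulo R x P ↔ IsFractionModulo R x Q) {p : Polynomial R}
    (hp : Polynomial.aeval x p ∈ P) : Polynomial.aeval x p ∈ Q := by
  obtain ⟨hP, hPpois⟩ := hP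
  obtain ⟨hQ, hQpois⟩ := hQ
  let _ := residueFieldPoisson hPpois
  let _ := residueFieldPoisson hQpois
  rw [← residueMap_eq_zero (k := k)] at hp ⊢
  refine hx.map_aeval_eq_zero hc (isDifferentialPoissonHom_residueMap hPpois D hDP)
    (isDifferentialPoissonHom_residueMap hQpois D hDQ) (fun r hr => ?_) ?_ hp
  · rw [residueMap_eq_zero, residueMap_eq_zero, hR r hr]
  · simpa only [IsFractionModulo, hP, hQ, exists_true_left] using hfrac

end FractionModulo

variable [PoissonAlgebra k A] [CharZero k] {n : ℕ} {x : Fin n → A}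
  {D : Fin n → Derivation k A A} {c : Fin n → k}

theorem injOn_isFractionModulo (hgen : Algebra.adjoin k (Set.range x) = ⊤)
    (hx : ∀ i : Fin n, IsOreVariable (initialAdjoin k x i) (D i) (c i) (x i)) (hc : ∀ i, c i ≠ 0) :
    Set.InjOn (fun P => {i : Fin n | IsFractionModulo (initialAdjoin k x i) (x i) P})
      {P : Ideal A | IsPoissonPrime k P ∧ ∀ i, ∀ a ∈ P, D i a ∈ P} := by
  intro P hP Q hQ hPQ
  have hfrac (i : Fin n) := Set.ext_iff.1 hPQ i
  have hinit (j : ℕ) (hj : j ≤ n) : ∀ a ∈ initialAdjoin k x j, a ∈ P ↔ a ∈ Q := by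
    induction j with
    | zero =>
      intro a ha
      rw [initialAdjoin_zero, Algebra.mem_bot] at ha
      obtain ⟨b, rfl⟩ := ha
      have := hP.1.1
      have := hQ.1.1
      rw [← residueMap_eq_zero (k := k) (P := P), ← residueMap_eq_zero (k := k) (P := Q),
        AlgHom.commutes, AlgHom.commutes, map_eq_zero, map_eq_zero]
    | succ j ih =>
      intro a ha
      have hind := ih (Nat.le_of_succ_le hj)
      obtain ⟨p, rfl⟩ := exists_aeval_eq_of_mem_initialAdjoin ⟨j, hj⟩ ha
      exact ⟨(hx ⟨j, hj⟩).aeval_mem (hc _) hP.1 (hP.2 _) hQ.1 (hQ.2 _) hind (hfrac _),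
        (hx ⟨j, hj⟩).aeval_mem (hc _) hQ.1 (hQ.2 _) hP.1 (hP.2 _) (fun r hr => (hind r hr).symm)
          (hfrac _).symm⟩
  have htop : initialAdjoin k x n = ⊤ := (initialAdjoin_self x).trans hgen
  exact Ideal.ext fun a => hinit n le_rfl a (htop ▸ Algebra.mem_top)

theorem encard_isPoissonPrime_le (hgen : Algebra.adjoin k (Set.range x) = ⊤)
    (hx : ∀ i : Fin n, IsOreVariable (initialAdjoin k x i) (D i) (c i) (x i)) (hc : ∀ i, c i ≠ 0) :
    {P : Ideal A | IsPoissonPrime k P ∧ ∀ i, ∀ a ∈ P, D i a ∈ P}.encard ≤ 2 ^ n := by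
  refine (Set.encard_le_encard_of_injOn (Set.mapsTo_univ _ _)
    (injOn_isFractionModulo hgen hx hc)).trans_eq ?_
  rw [Set.encard_univ, ENat.card_eq_coe_fintype_card, Fintype.card_set, Fintype.card_fin]
  norm_cast

end Generators

end PoissonAlgebra

theorem theorem1p10 {k : Type*} [Field k] [CharZero k] {A : Type*} [CommRing A] [Algebra k A]
    [PoissonAlgebra k A] {r : ℕ} (ρ : (Fin r → kˣ) →* (A ≃ₐ[k] A))
    (hrat : TorusAction.IsRational ρ) (hpois : TorusAction.IsPoisson ρ)
    {n : ℕ} (x : Fin n → A) (hx : ∀ i, TorusAction.IsEigenvector ρ (x i))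
    (hgen : Algebra.adjoin k (Set.range x) = ⊤)
    (η : Fin n → (Fin r → k))
    (h1 : ∀ i j : Fin n, j < i →
      PoissonAlgebra.pb k (x i) (x j) - TorusAction.differential hrat (η i) (x j) * x i ∈
        Algebra.adjoin k (x '' {l | l < i}))
    (h2 : ∀ i, ∃ c : k, c ≠ 0 ∧
      Module.End.HasEigenvector (TorusAction.differential hrat (η i)) c (x i)) :
    {P : Ideal A | PoissonAlgebra.IsPoissonPrime k P ∧ TorusAction.IsStable ρ P}.encard ≤ 2 ^ n ∧
      PoissonAlgebra.DixmierMoeglin k A := by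
  let D (i : Fin n) := TorusAction.differentialDer hrat (η i)
  choose m hm using fun i => (hx i).exists_mem_weightSpace hrat
  have hD (i l : Fin n) : D i (x l) = (∑ s, η i s * (m l s : k)) • x l :=
    TorusAction.differential_apply hrat (η i) (hm l)
  have hne (i : Fin n) : ∑ s, η i s * (m i s : k) ≠ 0 := by
    obtain ⟨c, hc, hcx⟩ := h2 i
    exact smul_left_injective k hcx.2 (hcx.apply_eq_smul.symm.trans (hD i i)) ▸ hc
  have hOre := PoissonAlgebra.isOreVariable_initialAdjoin hD h1
  have hcount : {P : Ideal A | PoissonAlgebra.IsPoissonPrime k P ∧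
      TorusAction.IsStable ρ P}.encard ≤ 2 ^ n :=
    (Set.encard_le_encard fun _ hP =>
      And.intro hP.1 fun i _ => hP.2.differential_mem hrat (η i)).trans
      (PoissonAlgebra.encard_isPoissonPrime_le hgen hOre hne)
  have : Algebra.FiniteType k A :=
    ⟨Subalgebra.fg_def.2 ⟨Set.range x, Set.finite_range x, hgen⟩⟩
  exact ⟨hcount, TorusAction.dixmierMoeglin_of_finite hrat hpois
    (Set.finite_of_encard_le_coe (k := 2 ^ n) (by exact_mod_cast hcount))⟩
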